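/- Let $k$ be an algebraically closed field with $\operatorname{char}(k)\ne 2,3$, let $\mathbb F$ be the function field of a smooth projective curve over $k$, let $\overline{\mathbb F}$ be an algebraic closure of $\mathbb F$, and let $E/\mathbb F$ be an elliptic curve, given by a Weierstrass equation, with $j_E\notin k$. For $\alpha\in\overline{\mathbb F}$ and a finite extension $\mathbb K/\mathbb F$ containing $\alpha$, let $$h_{\mathbb F}(\alpha)=\frac1{[\mathbb K:\mathbb F]}\sum_{w}\max\{0,-\operatorname{ord}_w(\alpha)\},$$ where $w$ runs over the points of the smooth projective curve over $k$ with function field $\mathbb K$ and $\operatorname{ord}_w:\mathbb K^*\twoheadrightarrow\mathbb Z$ is the normalized valuation at $w$ (and the terms are $0$ for $\alpha=0$); this does not depend on $\mathbb K$, and we put $h_{\mathbb F}(\infty)=0$. For $P\in E(\overline{\mathbb F})$ let $$\hat h(P)=\lim_{n\to\infty}4^{-n}h_{\mathbb F}\bigl(x(2^nP)\bigr)$$ be the canonical height. This limit exists for every $P\in E(\overline{\mathbb F})$. Let $N\ge 0$ and let $P_0,\dots,P_N\in E(\overline{\mathbb F})$. Then $$\max_{0\le i\le N}\hat h(P_i)\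 \ge\ \frac1{2(N+1)^2}\sum_{\substack{0\le j,k\le N\\ j\ne k}}\hat h(P_j-P_k).$$ Moreover, equality holds if and only if $\hat h(P_0)=\cdots=\hat h(P_N)$ and $P_0+\cdots+P_N$ is a torsion point of $E(\overline{\mathbb F})$. -/

import Mathlib

/-- `F` is the function field of a (smooth projective) curve over `k`, i.e. an algebraic function
field in one variable over `k`: a finite extension of `k(t)` for some `t ∈ F` transcendental
over `k`. -/
def IsCurveFunctionField (k F : Type*) [Field k] [Field F] [Algebra k F] : Prop :=
  ∃ t : F, Transcendental k t ∧
    FiniteDimensional (IntermediateField.adjoin k ({t} : Set F)) F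

/-- For a finite extension `L / F` of a function field `F` over `k`, the set of normalized discrete
valuations `ord_w : L* ↠ ℤ` that are trivial on `k`, i.e. the points of the smooth projective
curve with function field `L`. A valuation is written multiplicatively with values in `ℤᵐ⁰`, so
`ord_w α = - WithZero.log (w α)` for `α ≠ 0`. -/
def normalizedPlaces (k F L : Type*) [Field k] [Field F] [Field L] [Algebra k F] [Algebra F L] :
    Set (Valuation L (WithZero (Multiplicative ℤ))) :=
  {w | Function.Surjective w ∧ ∀ c : k, c ≠ 0 → w (algebraMap F L (algebraMap k F c)) = 1}

/-- The `F`-normalized height of the point `[α, 1] ∈ ℙ¹(L)`, computed in the finite extension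
`L / F`: `[L : F]⁻¹ * ∑_w max (0, -ord_w α)`. If `e(w)` is the local degree of `w` over its
restriction to `F`, then `ord_w` is `e(w)` times the valuation extending the normalized valuation
of `F`, so the local degrees are already contained in this sum. The convention
`WithZero.log 0 = 0` gives the element `0` the height `0`. -/
noncomputable def heightIn (k F L : Type*) [Field k] [Field F] [Field L] [Algebra k F]
    [Algebra F L] (α : L) : ℝ :=
  (∑ᶠ w : normalizedPlaces k F L, max (0 : ℝ) ((WithZero.log (w.1 α) : ℤ) : ℝ)) /
    (Module.finrank F L : ℝ)

/-- The absolute `F`-normalized Weil height on an algebraic extension `Fbar` of `F`, of the point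
`[α, 1]`. It is computed in the finite extension `F(α) / F`. -/
noncomputable def weilHeight (k F : Type*) {Fbar : Type*} [Field k] [Field F] [Field Fbar]
    [Algebra k F] [Algebra F Fbar] (α : Fbar) : ℝ :=
  heightIn k F (IntermediateField.adjoin F ({α} : Set Fbar))
    (IntermediateField.AdjoinSimple.gen F α)

/-- The height `h_F(x(P))` of the `x`-coordinate, a point of `ℙ¹`, of a point of `E(Fbar)`.
The point at infinity has `x`-coordinate `[1, 0]`, whose height is `0`. -/
noncomputable def xHeight (k : Type*) {F Fbar : Type*} [Field k] [Field F] [Field Fbar]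
    [Algebra k F] [Algebra F Fbar] (E : WeierstrassCurve F) :
    (E.baseChange Fbar).toAffine.Point → ℝ
  | .zero => 0
  | .some x _ _ => weilHeight k F x

/-- The sequence `4⁻ⁿ h_F(x(2ⁿ P))` whose limit is the canonical height of `P`. -/
noncomputable def canonicalHeightSeq (k : Type*) {F Fbar : Type*} [Field k] [Field F] [Field Fbar]
    [DecidableEq Fbar] [Algebra k F] [Algebra F Fbar] (E : WeierstrassCurve F)
    (P : (E.baseChange Fbar).toAffine.Point) (n : ℕ) : ℝ :=
  ((4 : ℝ) ^ n)⁻¹ * xHeight k E ((2 ^ n : ℕ) • P)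

/-- The canonical height `ĥ(P) = lim 4⁻ⁿ h_F(x(2ⁿ P))` on `E(Fbar)`. -/
noncomputable def canonicalHeight (k : Type*) {F Fbar : Type*} [Field k] [Field F] [Field Fbar]
    [DecidableEq Fbar] [Algebra k F] [Algebra F Fbar] (E : WeierstrassCurve F)
    (P : (E.baseChange Fbar).toAffine.Point) : ℝ :=
  Filter.limUnder Filter.atTop (canonicalHeightSeq k E P)

/-!
The canonical height `ĥ` is a nonnegative quadratic form on `E(Fbar)`, and its zeros are exactly the
torsion points. The inequality and its equality case are formal consequences
(`max_ge_sum_offDiag_and_eq_iff`): by biadditivity of the polar form,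
`∑ ĥ(P_j - P_k) = 2 (N + 1) ∑ ĥ(P_i) - 2 ĥ(∑ P_i)`, so the right-hand side of the inequality is the
mean of the `ĥ(P_i)` minus `ĥ(∑ P_i) / (N + 1)²`, while the left-hand side is their maximum.

*Heights.* For a function field `K` over `k`, `curveHeight k a` counts the poles of `a`. The basic
input is the degree formula `zeroPlaces_finite_and_sum`: a transcendental `t` has `[K : k(t)]`
zeros. For a separating `t` it is the fundamental identity for the integral closure of `k[t]`, and
in general one extracts `p`-th roots. It yields the finiteness of all sums over places, the product
formula `finsum_log_eq_zero`, the positivity of the height of nonconstant elements, and the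
independence of the Weil height of the field in which it is computed.

*Quadraticity.* Let `e₁`, `e₂`, `e₃` be the roots of the `2`-torsion polynomial. The Legendre
coordinate `u = (x - e₁) / (e₂ - e₁)` puts the curve in the form `y² = u (u - 1) (u - l)` up to a
twist, and changes heights by a bounded amount only. The classical formulas for
`u(P + Q) + u(P - Q)`, `u(P + Q) u(P - Q)` and `u(2 P)` give
`h(P + Q) + h(P - Q) ≤ 2 h(P) + 2 h(Q) + O(1)` and `4 h(P) ≤ h(2 P) + O(1)`. This is enough: the
second bound and the case `P = Q` of the first make `4⁻ⁿ h(2ⁿ P)` a Cauchy sequence, and the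
parallelogram inequality for the limit, applied to `P + Q` and `P - Q`, is its own reverse
(`parallelogram_law_of_tendsto`).

*Points of height zero.* Here `j ∉ k` enters, in the form `l ∉ k`. Let `P` have infinite order. By a
pigeonhole argument on the component groups, some positive multiple `n P` has nonsingular reduction
at all places on a model that is semistable there
(`LegendreSeq.exists_forall_nonsingularReduction`), and then so do all multiples of `n P`. For such
points duplication multiplies the modified height `∑ log max (1, |u|, |l|)` by exactly `4`. As this
height is at least `h(l) > 0`, it follows that `ĥ(n P) ≥ h(l) > 0`
(`LegendreSeq.exists_pow_mul_curveHeight_le`).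
-/

/-! ### Extracting roots in function fields -/

section

open IntermediateField Polynomial

/-- A field that is finite over `k(s)` is finite over `k(t)` for every `t` transcendental
over `k`. -/
theorem finiteDimensional_adjoin_of_transcendental {k K : Type*} [Field k] [Field K] [Algebra k K]
    {s t : K} [FiniteDimensional k⟮s⟯ K] (hs : Transcendental k s) (ht : Transcendental k t) :
    FiniteDimensional k⟮t⟯ K := by
  have halg : IsAlgebraic k⟮t⟯ s :=
    isAlgebraic_adjoin_iff.mpr (.adjoin_singleton hs ht
      (isAlgebraic_adjoin_iff.mp (Algebra.IsAlgebraic.isAlgebraic (R := k⟮s⟯) t)))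
  have h1 : FiniteDimensional k⟮t⟯ k⟮t⟯⟮s⟯ := adjoin.finiteDimensional halg.isIntegral
  have h2 : FiniteDimensional k⟮t⟯⟮s⟯ K := by
    have hle : k⟮s⟯ ≤ (k⟮t⟯⟮s⟯).restrictScalars k := by
      rw [adjoin_simple_le_iff]
      exact mem_adjoin_simple_self k⟮t⟯ s
    let : Algebra k⟮s⟯ k⟮t⟯⟮s⟯ := (inclusion hle).toRingHom.toAlgebra
    have : IsScalarTower k⟮s⟯ k⟮t⟯⟮s⟯ K := IsScalarTower.of_algebraMap_eq fun _ ↦ rfl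
    exact Module.Finite.of_restrictScalars_finite k⟮s⟯ k⟮t⟯⟮s⟯ K
  exact Module.Finite.trans k⟮t⟯⟮s⟯ K

/-- An element `r` that is not a `p`-th power is a separating element: `K` has degree at most `p`
over the field `Kᵖ` of `p`-th powers, so `K = Kᵖ(r)`, and every derivation of `K` over `k(r)`
kills both `Kᵖ` and `r`. -/
theorem isSeparable_adjoin_of_notMem_range_frobenius {k K : Type*} [Field k] [Field K]
    [Algebra k K] [PerfectField k] (p : ℕ) [Fact p.Prime] [CharP K p] {r : K}
    [FiniteDimensional k⟮r⟯ K] (hrt : Transcendental k r) (hr : ∀ x : K, x ^ p ≠ r) :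
    Algebra.IsSeparable k⟮r⟯ K := by
  have hp : p.Prime := Fact.out
  have hkp : CharP k p := (algebraMap k K).charP (algebraMap k K).injective p
  have : ExpChar k p := .prime hp
  have : PerfectRing k p := PerfectField.toPerfectRing p
  -- the field of `p`-th powers
  let Kp : IntermediateField k K :=
    { (frobenius K p).fieldRange with
      algebraMap_mem' := fun c ↦ ⟨algebraMap k K ((frobeniusEquiv k p).symm c), by
        rw [frobenius_def, ← map_pow, ← frobenius_def, frobenius_apply_frobeniusEquiv_symm]⟩ }
  have hKp : ∀ x : K, x ^ p ∈ Kp := fun x ↦ ⟨x, rfl⟩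
  have hirr : ∀ x : K, x ∉ Kp → Irreducible (X ^ p - C (⟨x ^ p, hKp x⟩ : Kp)) := by
    refine fun x hx ↦ X_pow_sub_C_irreducible_of_prime hp fun b hb ↦ hx ?_
    have h1 : frobenius K p b = frobenius K p x := congrArg Subtype.val hb
    rw [← frobenius_inj K p h1]
    exact b.2
  have hroot : ∀ x : K, aeval x (X ^ p - C (⟨x ^ p, hKp x⟩ : Kp)) = 0 := fun x ↦ by
    simp [IntermediateField.algebraMap_apply]
  have hmonic : ∀ x : K, (X ^ p - C (⟨x ^ p, hKp x⟩ : Kp)).Monic := fun x ↦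
    monic_X_pow_sub_C _ hp.ne_zero
  have hint : ∀ x : K, IsIntegral Kp x := fun x ↦ ⟨_, hmonic x, hroot x⟩
  -- a separating element generates `K` over the field of `p`-th powers
  obtain ⟨s, hs⟩ : ∃ s : K, Kp⟮s⟯ = ⊤ := by
    have : Algebra.EssFiniteType k K := by
      have : Algebra.EssFiniteType k k⟮r⟯ := by
        rw [IntermediateField.essFiniteType_iff]
        exact ⟨{r}, by simp⟩
      exact Algebra.EssFiniteType.comp k k⟮r⟯ K
    obtain ⟨S, hS, hsep⟩ := exists_isTranscendenceBasis_and_isSeparable_of_perfectField k K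
    have hcard : S.card = 1 := by
      have h2 : IsTranscendenceBasis k (fun _ : Unit ↦ r) := by
        have : AlgebraicIndependent k (fun _ : Unit ↦ r) :=
          algebraicIndependent_unique_type_iff.mpr hrt
        refine (isTranscendenceBasis_iff_algebraicIndependent_isAlgebraic).mpr ⟨this, ?_⟩
        have : Set.range (fun _ : Unit ↦ r) = {r} := by simp
        rw [this]
        have h3 : Algebra.IsAlgebraic k⟮r⟯ K := inferInstance
        exact isAlgebraic_adjoin_iff_top.mp h3
      simpa using hS.lift_cardinalMk_eq h2
    obtain ⟨s, rfl⟩ := Finset.card_eq_one.mp hcard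
    refine ⟨s, ?_⟩
    rw [eq_top_iff]
    rintro x -
    have hle : k⟮s⟯ ≤ (Kp⟮s⟯).restrictScalars k := by
      rw [adjoin_simple_le_iff]
      exact mem_adjoin_simple_self Kp s
    rw [Finset.coe_singleton] at hsep
    let : Algebra k⟮s⟯ Kp⟮s⟯ := (inclusion hle).toRingHom.toAlgebra
    have : IsScalarTower k⟮s⟯ Kp⟮s⟯ K := IsScalarTower.of_algebraMap_eq fun _ ↦ rfl
    have : Algebra.IsSeparable Kp⟮s⟯ K := Algebra.isSeparable_tower_top_of_isSeparable k⟮s⟯ _ _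
    have : ExpChar Kp⟮s⟯ p := .prime hp
    have : IsPurelyInseparable Kp⟮s⟯ K := (isPurelyInseparable_iff_pow_mem _ p).mpr fun y ↦
      ⟨1, ⟨algebraMap Kp Kp⟮s⟯ ⟨y ^ p, hKp y⟩, by simp⟩⟩
    obtain ⟨y, hy⟩ := IsPurelyInseparable.surjective_algebraMap_of_isSeparable Kp⟮s⟯ K x
    exact hy ▸ y.2
  have hfin : FiniteDimensional Kp K := by
    have := adjoin.finiteDimensional (hint s)
    rw [hs] at this
    exact Module.Finite.equiv (topEquiv (F := Kp) (E := K)).toLinearEquiv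
  have hle : Module.finrank Kp K ≤ p := by
    have h1 := adjoin.finrank (hint s)
    rw [hs, finrank_top'] at h1
    rw [h1, ← natDegree_X_pow_sub_C (n := p) (r := (⟨s ^ p, hKp s⟩ : Kp))]
    exact natDegree_le_of_dvd (minpoly.dvd _ _ (hroot s)) (hmonic s).ne_zero
  have hgen : Kp⟮r⟯ = ⊤ := by
    have hrKp : r ∉ Kp := fun ⟨x, hx⟩ ↦ hr x hx
    have h1 := adjoin.finrank (hint r)
    rw [← minpoly.eq_of_irreducible_of_monic (hirr r hrKp) (hroot r) (hmonic r),
      natDegree_X_pow_sub_C] at h1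
    exact eq_of_le_of_finrank_le le_top (by rwa [finrank_top', h1])
  have : Algebra.EssFiniteType k⟮r⟯ K := inferInstance
  rw [← Algebra.FormallyUnramified.iff_isSeparable]
  -- the constants of the universal derivation form a field containing `Kᵖ` and `r`
  let D := KaehlerDifferential.D k⟮r⟯ K
  have hD : ∀ x : K, D x = 0 := by
    intro x
    have hx : x ∈ Kp⟮r⟯ := hgen ▸ mem_top
    induction hx using adjoin_induction with
    | mem y hy =>
      obtain rfl : y = r := hy
      exact D.map_algebraMap (AdjoinSimple.gen k y)
    | algebraMap y =>
      obtain ⟨_, z, rfl⟩ := y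
      change D (z ^ p) = 0
      rw [D.leibniz_pow, ← Nat.cast_smul_eq_nsmul K, CharP.cast_eq_zero, zero_smul]
    | add y z _ _ hy hz => rw [map_add, hy, hz, add_zero]
    | inv y _ hy => rw [D.leibniz_inv, hy, smul_zero]
    | mul y z _ _ hy hz => rw [D.leibniz, hy, hz, smul_zero, smul_zero, add_zero]
  refine ⟨⟨fun a b ↦ ?_⟩⟩
  have hbot : (⊤ : Submodule K (Ω[K⁄k⟮r⟯])) = ⊥ := by
    rw [← KaehlerDifferential.span_range_derivation, Submodule.span_eq_bot]
    rintro _ ⟨x, rfl⟩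
    exact hD x
  have h0 : ∀ c : Ω[K⁄k⟮r⟯], c = 0 := fun c ↦ (Submodule.mem_bot K).mp (hbot ▸ Submodule.mem_top)
  rw [h0 a, h0 b]

/-- Taking `p`-th powers multiplies the degree over `k(r)` by `p`. -/
theorem finrank_adjoin_pow {k K : Type*} [Field k] [Field K]
    [Algebra k K] (p : ℕ) [Fact p.Prime] [CharP K p] {r : K} (hrt : Transcendental k r) :
    Module.finrank k⟮r ^ p⟯ K = p * Module.finrank k⟮r⟯ K := by
  have hp : p.Prime := Fact.out
  have hr : r ∉ k⟮r ^ p⟯ := by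
    intro h
    obtain ⟨f, g, hfg⟩ := (mem_adjoin_simple_iff k r).mp h
    have hr0 : r ≠ 0 := fun h ↦ hrt (h ▸ isAlgebraic_zero)
    have hg : aeval (r ^ p) g ≠ 0 := fun h ↦ hr0 (by rw [hfg, h, div_zero])
    have hg0 : g ≠ 0 := by rintro rfl; simp at hg
    have h1 : aeval r (X * expand k p g - expand k p f) = 0 := by
      rw [eq_div_iff hg] at hfg
      simp [expand_aeval, hfg]
    have h2 : X * expand k p g = expand k p f := sub_eq_zero.mp (by
      by_contra h; exact hrt ⟨_, h, h1⟩)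
    have h3 := congrArg natDegree h2
    rw [natDegree_X_mul ((expand_ne_zero hp.pos).mpr hg0), natDegree_expand, natDegree_expand] at h3
    have h4 : p ∣ 1 := (Nat.dvd_add_right (Dvd.intro_left g.natDegree rfl)).mp
      (h3 ▸ Dvd.intro_left f.natDegree rfl)
    exact hp.one_lt.ne' (Nat.dvd_one.mp h4)
  set M := k⟮r ^ p⟯ with hM
  have hmem : r ^ p ∈ M := mem_adjoin_simple_self k _
  have hirr : Irreducible (X ^ p - C (⟨r ^ p, hmem⟩ : M)) := by
    refine X_pow_sub_C_irreducible_of_prime hp fun b hb ↦ hr ?_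
    have h1 : frobenius K p b = frobenius K p r := congrArg Subtype.val hb
    rw [← frobenius_inj K p h1]
    exact b.2
  have hroot : aeval r (X ^ p - C (⟨r ^ p, hmem⟩ : M)) = 0 := by
    simp [IntermediateField.algebraMap_apply]
  have hmonic : (X ^ p - C (⟨r ^ p, hmem⟩ : M)).Monic := monic_X_pow_sub_C _ hp.ne_zero
  have h1 : Module.finrank M M⟮r⟯ = p := by
    rw [adjoin.finrank ⟨_, hmonic, hroot⟩,
      ← minpoly.eq_of_irreducible_of_monic hirr hroot hmonic, natDegree_X_pow_sub_C]
  have h2 : (M⟮r⟯).restrictScalars k = k⟮r⟯ := by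
    apply le_antisymm
    · have : M ≤ k⟮r⟯ := by
        rw [hM, adjoin_simple_le_iff]
        exact pow_mem (mem_adjoin_simple_self k r) p
      have h : M⟮r⟯ ≤ extendScalars this := by
        rw [adjoin_simple_le_iff]
        exact mem_adjoin_simple_self k r
      exact fun x hx ↦ h hx
    · rw [adjoin_simple_le_iff]
      exact mem_adjoin_simple_self M r
  have h3 : Module.finrank M⟮r⟯ K = Module.finrank k⟮r⟯ K := by
    rw [← h2]; rfl
  rw [← Module.finrank_mul_finrank M M⟮r⟯ K, h1, h3]

end

/-! ### Places and the zeros of a separable function -/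

section

open IntermediateField Polynomial
open scoped WithZero

/-- The points of the smooth projective curve over `k` with function field `K`, as normalized
discrete valuations of `K` that are trivial on `k`. -/
def places (k K : Type*) [Field k] [Field K] [Algebra k K] :
    Set (Valuation K (WithZero (Multiplicative ℤ))) :=
  {w | Function.Surjective w ∧ ∀ c : k, c ≠ 0 → w (algebraMap k K c) = 1}

theorem places.map_algebraMap_le_one {k K : Type*} [Field k] [Field K] [Algebra k K]
    {w : Valuation K (WithZero (Multiplicative ℤ))} (hw : w ∈ places k K) (c : k) :
    w (algebraMap k K c) ≤ 1 := by
  rcases eq_or_ne c 0 with rfl | hc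
  · simp
  · exact (hw.2 c hc).le

/-- A normalized discrete valuation is determined by its valuation ring, which is maximal among
the valuation rings of `K` that belong to such valuations. -/
theorem Valuation.eq_of_le_one_imp_le_one {K : Type*} [Field K]
    {v w : Valuation K (WithZero (Multiplicative ℤ))} (hv : Function.Surjective v)
    (hw : Function.Surjective w) (h : ∀ x, v x ≤ 1 → w x ≤ 1) : v = w := by
  obtain ⟨π, hπ⟩ := hv (WithZero.exp (-1))
  have hπ0 : π ≠ 0 := by rintro rfl; rw [map_zero] at hπ; exact WithZero.exp_ne_zero hπ.symm
  have hunit : ∀ x, v x = 1 → w x = 1 := fun x hx ↦ by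
    have hx0 : x ≠ 0 := by rintro rfl; simp at hx
    refine le_antisymm (h x hx.le) ?_
    have := h x⁻¹ (by rw [map_inv₀, hx, inv_one])
    rw [map_inv₀] at this
    exact (inv_le_one₀ (zero_lt_iff.mpr ((w.ne_zero_iff).mpr hx0))).mp this
  have hpow : ∀ x, x ≠ 0 → ∃ n : ℤ, v x = v π ^ n ∧ w x = w π ^ n := by
    intro x hx
    have hvx : v x = v π ^ (-(WithZero.log (v x))) := by
      rw [hπ, ← WithZero.exp_zsmul]
      simp [WithZero.exp_log ((v.ne_zero_iff).mpr hx)]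
    refine ⟨_, hvx, ?_⟩
    have h1 : v (x / π ^ (-(WithZero.log (v x)))) = 1 := by
      rw [map_div₀, map_zpow₀, ← hvx, div_self ((v.ne_zero_iff).mpr hx)]
    have h2 := hunit _ h1
    rw [map_div₀, map_zpow₀] at h2
    exact eq_of_div_eq_one h2
  have hwπ : w π = WithZero.exp (-1) := by
    have hle : w π ≤ 1 := h π (by rw [hπ]; exact WithZero.exp_le_exp.mpr (by norm_num))
    have hw0 : w π ≠ 0 := (w.ne_zero_iff).mpr hπ0
    obtain ⟨x, hx⟩ := hw (WithZero.exp (-1))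
    have hx0 : x ≠ 0 := by rintro rfl; rw [map_zero] at hx; exact WithZero.exp_ne_zero hx.symm
    obtain ⟨n, -, hn⟩ := hpow x hx0
    rw [hx, ← WithZero.exp_log hw0, ← WithZero.exp_zsmul] at hn
    have h1 := WithZero.exp_injective hn
    rw [← WithZero.exp_log hw0, ← WithZero.exp_zero, WithZero.exp_le_exp] at hle
    have h2 : WithZero.log (w π) = -1 := by
      have h3 : WithZero.log (w π) ∣ -1 := ⟨n, by rw [h1, smul_eq_mul, mul_comm]⟩
      have h4 := Int.natAbs_dvd_natAbs.mpr h3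
      have h5 : (WithZero.log (w π)).natAbs = 1 := by simpa using h4
      omega
    rw [← h2, WithZero.exp_log hw0]
  ext x
  rcases eq_or_ne x 0 with rfl | hx
  · simp
  · obtain ⟨n, h1, h2⟩ := hpow x hx
    rw [h1, h2, hπ, hwπ]

/-- The places where `t` vanishes. -/
def zeroPlaces (k : Type*) {K : Type*} [Field k] [Field K] [Algebra k K] (t : K) :
    Set (Valuation K (WithZero (Multiplicative ℤ))) :=
  {w ∈ places k K | w t < 1}

/-- Over an algebraically closed field `k`, there is no residue field extension above a maximal
ideal `p` whose residue field is `k`. -/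
theorem Ideal.inertiaDeg_eq_one_of_isAlgClosed {k A B : Type*} [Field k] [IsAlgClosed k]
    [CommRing A] [CommRing B] [Algebra k A] [Algebra A B] [Algebra k B] [IsScalarTower k A B]
    [Module.Finite A B] (p : Ideal A) [p.IsMaximal] (P : Ideal B) [P.IsMaximal] [P.LiesOver p]
    (hp : ∀ a : A, ∃ c : k, a - algebraMap k A c ∈ p) : P.inertiaDeg A = 1 := by
  refine le_antisymm ?_ (Ideal.inertiaDeg_pos P A)
  rw [Ideal.inertiaDeg_eq_of_isMaximal p P]
  have h1 : Module.Finite k (A ⧸ p) := by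
    refine Module.Finite.of_surjective (Algebra.linearMap k (A ⧸ p)) fun a ↦ ?_
    obtain ⟨a, rfl⟩ := Ideal.Quotient.mk_surjective a
    obtain ⟨c, hc⟩ := hp a
    exact ⟨c, (Ideal.Quotient.eq.mpr hc).symm⟩
  have h2 : Module.Finite k (B ⧸ P) := Module.Finite.trans (A ⧸ p) _
  have h3 := IsAlgClosed.algebraMap_bijective_of_isIntegral (k := k) (K := B ⧸ P)
  refine finrank_le_one 1 fun b ↦ ?_
  obtain ⟨c, rfl⟩ := h3.2 b
  exact ⟨algebraMap k (A ⧸ p) c, by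
    rw [Algebra.smul_def, mul_one, ← IsScalarTower.algebraMap_apply]⟩

set_option maxHeartbeats 800000 in
open scoped algebraAdjoinAdjoin in
/-- The degree formula for a separating element `t`. The zeros of `t` are the primes over `(t)` of
the integral closure of `k[t]`, their orders are the ramification indices, and all inertia degrees
are `1` since `k` is algebraically closed. -/
theorem zeroPlaces_finite_and_sum_of_isSeparable {k K : Type*} [Field k] [IsAlgClosed k] [Field K]
    [Algebra k K] {t : K} (ht : Transcendental k t) [FiniteDimensional k⟮t⟯ K]
    [Algebra.IsSeparable k⟮t⟯ K] :
    (zeroPlaces k t).Finite ∧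
      ∑ᶠ w ∈ zeroPlaces k t, -WithZero.log (w t) = (Module.finrank k⟮t⟯ K : ℤ) := by
  let A := Algebra.adjoin k ({t} : Set K)
  let T : A := ⟨t, Algebra.self_mem_adjoin_singleton k t⟩
  have hsurj : Function.Surjective (aeval T : k[X] →ₐ[k] A) := by
    rintro ⟨a, ha⟩
    have ha' := ha
    rw [show A = _ from Algebra.adjoin_singleton_eq_range_aeval k t] at ha'
    obtain ⟨f, rfl⟩ := ha'
    exact ⟨f, Subtype.ext (by simp [T])⟩
  have hpir : IsPrincipalIdealRing A :=
    IsPrincipalIdealRing.of_surjective (aeval T : k[X] →ₐ[k] A).toRingHom hsurj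
  let B := integralClosure A K
  have hfin : Module.Finite A B := IsIntegralClosure.finite A k⟮t⟯ K B
  have hded : IsDedekindDomain B := integralClosure.isDedekindDomain A k⟮t⟯ K
  have hfrac : IsFractionRing B K := integralClosure.isFractionRing_of_finite_extension k⟮t⟯ K
  let p : Ideal A := Ideal.span {T}
  have hquot : ∀ a : A, ∃ c : k, a - algebraMap k A c ∈ p := by
    intro a
    obtain ⟨f, rfl⟩ := hsurj a
    refine ⟨f.coeff 0, Ideal.mem_span_singleton.mpr ?_⟩
    have h1 : X ∣ f - C (f.coeff 0) := X_dvd_iff.mpr (by simp)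
    simpa using map_dvd (aeval T) h1
  have hp1 : p ≠ ⊤ := by
    intro h
    obtain ⟨a, ha⟩ := Ideal.mem_span_singleton'.mp ((Ideal.eq_top_iff_one p).mp h)
    obtain ⟨f, rfl⟩ := hsurj a
    refine ht ⟨f * X - 1, fun h0 ↦ ?_, ?_⟩
    · simpa using congrArg (coeff · 0) h0
    · have := congrArg (algebraMap A K) ha
      rw [map_mul, ← aeval_algebraMap_apply, map_one] at this
      rw [map_sub, map_mul, aeval_X, map_one, sub_eq_zero]
      exact this
  have hmax : p.IsMaximal := by
    refine Ideal.isMaximal_iff.mpr ⟨(Ideal.ne_top_iff_one p).mp hp1, fun J x hJ hxp hxJ ↦ ?_⟩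
    obtain ⟨c, hc⟩ := hquot x
    have hc0 : c ≠ 0 := by rintro rfl; exact hxp (by simpa using hc)
    have h1 : algebraMap k A c ∈ J := by
      have := J.sub_mem hxJ (hJ hc)
      rwa [sub_sub_cancel] at this
    have h2 := J.mul_mem_left (algebraMap k A c⁻¹) h1
    rwa [← map_mul, inv_mul_cancel₀ hc0, map_one] at h2
  have ht0 : t ≠ 0 := fun h ↦ ht (h ▸ isAlgebraic_zero)
  have hp0 : p ≠ ⊥ := by
    rw [Ne, Ideal.span_singleton_eq_bot]
    exact fun h ↦ ht0 (congrArg Subtype.val h)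
  let TB : B := algebraMap A B T
  have hTB : algebraMap B K TB = t := rfl
  have hTB0 : TB ≠ 0 := fun h ↦ ht0 (by rw [← hTB, h, map_zero])
  have hmap : p.map (algebraMap A B) = Ideal.span {TB} := by
    rw [Ideal.map_span, Set.image_singleton]
  have hTmem : ∀ P : p.primesOver B, TB ∈ P.1 := fun P ↦ by
    have := P.2.2
    exact (Ideal.mem_of_liesOver P.1 p T).mp (Ideal.mem_span_singleton_self T)
  let hs : p.primesOver B → IsDedekindDomain.HeightOneSpectrum B := fun P ↦
    ⟨P.1, P.2.1, fun h ↦ hTB0 (by simpa [h] using hTmem P)⟩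
  let val : p.primesOver B → Valuation K (WithZero (Multiplicative ℤ)) := fun P ↦
    (hs P).valuation K
  have hval_inj : Function.Injective val := by
    intro P Q hPQ
    refine Subtype.ext (Ideal.ext fun b ↦ ?_)
    have h1 := (hs P).valuation_lt_one_iff_mem (K := K) b
    have h2 := (hs Q).valuation_lt_one_iff_mem (K := K) b
    exact h1.symm.trans ((by rw [show (hs P).valuation K = (hs Q).valuation K from hPQ] :
      _ ↔ _).trans h2)
  have hval_mem : ∀ P, val P ∈ zeroPlaces k t := by
    refine fun P ↦ ⟨⟨(hs P).valuation_surjective K, fun c hc ↦ ?_⟩, ?_⟩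
    · have hle : ∀ d : k, val P (algebraMap k K d) ≤ 1 := fun d ↦ by
        have h1 := (hs P).valuation_le_one (K := K) (algebraMap A B (algebraMap k A d))
        exact h1
      refine le_antisymm (hle c) ?_
      have h1 := hle c⁻¹
      rw [map_inv₀, map_inv₀] at h1
      exact (inv_le_one₀ (zero_lt_iff.mpr (((val P).ne_zero_iff).mpr
        ((_root_.map_ne_zero _).mpr hc)))).mp h1
    · rw [← hTB]
      exact ((hs P).valuation_lt_one_iff_mem TB).mpr (hTmem P)
  have hval_surj : ∀ w ∈ zeroPlaces k t, ∃ P, val P = w := by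
    rintro w ⟨hw, hwt⟩
    have hA : ∀ a : A, w a ≤ 1 := by
      intro a
      obtain ⟨f, rfl⟩ := hsurj a
      induction f using Polynomial.induction_on' with
      | add f g hf hg =>
        rw [map_add]
        exact (w.map_add _ _).trans (max_le hf hg)
      | monomial n c =>
        rw [aeval_monomial]
        refine (map_mul w _ _).trans_le (mul_le_one' (places.map_algebraMap_le_one hw c) ?_)
        exact (map_pow w _ _).trans_le (pow_le_one' hwt.le n)
    have hB : ∀ b : B, w b ≤ 1 := by
      intro b
      have hint : IsIntegral A (b : K) := b.2
      let φ : A →+* w.integer := (algebraMap A K).codRestrict w.integer hA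
      have : IsIntegral w.integer (b : K) := by
        obtain ⟨f, hf, hf0⟩ := hint
        refine ⟨f.map φ, hf.map φ, ?_⟩
        rw [eval₂_map]
        exact hf0
      exact (Valuation.integer.integers w).mem_of_integral this
    let P : Ideal B :=
      { carrier := {b | w b < 1}
        add_mem' := fun {a b} ha hb ↦ (w.map_add _ _).trans_lt (max_lt ha hb)
        zero_mem' := by simp
        smul_mem' := fun c x hx ↦ by
          change w (c * x : K) < 1
          rw [map_mul]
          exact (mul_le_of_le_one_left' (hB c)).trans_lt hx }
    have hPprime : P.IsPrime := by
      refine ⟨(Ideal.ne_top_iff_one P).mpr fun h ↦ ?_, fun {x y} hxy ↦ ?_⟩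
      · have : w (1 : K) < 1 := h
        simp at this
      · by_contra! h
        have hx : w x = 1 := le_antisymm (hB x) (not_lt.mp h.1)
        have hy : w y = 1 := le_antisymm (hB y) (not_lt.mp h.2)
        have hxy' : w (x * y : K) < 1 := hxy
        rw [map_mul, hx, hy, mul_one] at hxy'
        exact lt_irrefl _ hxy'
    have hover : P.LiesOver p := by
      refine ⟨hmax.eq_of_le (Ideal.IsPrime.under A P).ne_top ?_⟩
      rw [Ideal.span_singleton_le_iff_mem]
      exact hwt
    refine ⟨⟨P, hPprime, hover⟩, ?_⟩
    refine Valuation.eq_of_le_one_imp_le_one ((hs _).valuation_surjective K) hw.1 fun x hx ↦ ?_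
    obtain ⟨a, b, hab⟩ := (hs ⟨P, hPprime, hover⟩).exists_primeCompl_mul_eq_of_integer x hx
    have hb : w (b.1 : K) = 1 := le_antisymm (hB b.1) (not_lt.mp b.2)
    have h1 : w x * w (b.1 : K) = w (a : K) := (map_mul w _ _).symm.trans (congrArg w hab)
    rw [hb, mul_one] at h1
    exact h1 ▸ hB a
  have hrange : zeroPlaces k t = Set.range val :=
    Set.Subset.antisymm (fun w hw ↦ hval_surj w hw) (by rintro _ ⟨P, rfl⟩; exact hval_mem P)
  refine ⟨hrange ▸ Set.finite_range val, ?_⟩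
  rw [hrange, finsum_mem_range hval_inj, finsum_eq_sum_of_fintype,
    ← IsIntegralClosure.rank A k⟮t⟯ K B,
    ← Ideal.sum_ramification_inertia_eq_finrank p B, Nat.cast_sum]
  refine Finset.sum_congr rfl fun P _ ↦ ?_
  have hPprime : P.1.IsPrime := P.2.1
  have hover : P.1.LiesOver p := P.2.2
  have hPmax : P.1.IsMaximal := Ideal.IsMaximal.of_liesOver_isMaximal P.1 p
  have hinertia : P.1.inertiaDeg A = 1 := Ideal.inertiaDeg_eq_one_of_isAlgClosed p P.1 hquot
  have hmapne : p.map (algebraMap A B) ≠ ⊥ := by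
    rwa [hmap, Ne, Ideal.span_singleton_eq_bot]
  rw [hinertia, mul_one, Ideal.IsDedekindDomain.ramificationIdx_eq_multiplicity p P.1 hmapne, hmap]
  change -WithZero.log ((hs P).valuation K (algebraMap B K TB)) = _
  rw [(hs P).valuation_of_algebraMap, (hs P).intValuation_eq_exp_neg_multiplicity hTB0]
  simp [hs]

end

/-! ### The degree formula, heights and the product formula -/

section

open IntermediateField Polynomial
open scoped WithZero

/-- The degree formula: `t` has exactly `[K : k(t)]` zeros, counted with multiplicity. The
inseparable case reduces to the separable one by extracting `p`-th roots of `t`, which divides both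
sides by `p`. -/
theorem zeroPlaces_finite_and_sum {k K : Type*} [Field k] [IsAlgClosed k] [Field K]
    [Algebra k K] {t : K} (ht : Transcendental k t) [FiniteDimensional k⟮t⟯ K] :
    (zeroPlaces k t).Finite ∧
      ∑ᶠ w ∈ zeroPlaces k t, -WithZero.log (w t) = (Module.finrank k⟮t⟯ K : ℤ) := by
  obtain ⟨p, hp⟩ := ExpChar.exists K
  rcases hp with _ | hp
  · have : CharZero k⟮t⟯ := (RingHom.charZero_iff (algebraMap k⟮t⟯ K).injective).mpr inferInstance
    exact zeroPlaces_finite_and_sum_of_isSeparable ht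
  have : Fact p.Prime := ⟨hp⟩
  obtain ⟨n, hn⟩ : ∃ n, Module.finrank k⟮t⟯ K = n := ⟨_, rfl⟩
  induction n using Nat.strong_induction_on generalizing t with
  | _ n ih =>
    by_cases hpow : ∀ x : K, x ^ p ≠ t
    · have := isSeparable_adjoin_of_notMem_range_frobenius p ht hpow
      exact zeroPlaces_finite_and_sum_of_isSeparable ht
    · push Not at hpow
      obtain ⟨r, rfl⟩ := hpow
      have hr : Transcendental k r := fun h ↦ ht (h.pow p)
      have hfin : FiniteDimensional k⟮r⟯ K := finiteDimensional_adjoin_of_transcendental ht hr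
      have hdeg := finrank_adjoin_pow (K := K) p hr
      have hpos : 0 < Module.finrank k⟮r⟯ K := Module.finrank_pos
      obtain ⟨h1, h2⟩ := ih _ (by rw [← hn, hdeg]; exact lt_mul_of_one_lt_left hpos hp.one_lt)
        hr rfl
      have hz : zeroPlaces k (r ^ p) = zeroPlaces k r := by
        ext w
        simp [zeroPlaces, map_pow, pow_lt_one_iff hp.ne_zero]
      rw [hz, hdeg, Nat.cast_mul, ← h2, mul_finsum_mem]
      refine ⟨h1, finsum_mem_congr rfl fun w _ ↦ ?_⟩
      rw [map_pow, WithZero.log_pow]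
      simp

/-- The number of poles of `a`, counted with multiplicity, as the sum of `log⁺ |a|_w` over all
places. -/
noncomputable def curveHeight (k : Type*) {K : Type*} [Field k] [Field K] [Algebra k K]
    (a : K) : ℤ :=
  ∑ᶠ w : places k K, WithZero.log (max 1 (w.1 a))

section curveHeight

variable {k K : Type*} [Field k] [Field K] [Algebra k K]

theorem log_max_one_eq_zero_iff {x : WithZero (Multiplicative ℤ)} :
    WithZero.log (max 1 x) = 0 ↔ x ≤ 1 := by
  constructor
  · intro h
    by_contra! h1
    rw [max_eq_right h1.le, ← WithZero.log_one] at h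
    exact ((WithZero.log_lt_log one_ne_zero (zero_lt_one.trans h1).ne').mpr h1).ne' h
  · intro h
    rw [max_eq_left h, WithZero.log_one]

theorem curveHeight_algebraMap (c : k) : curveHeight k (algebraMap k K c) = 0 := by
  rw [curveHeight, ← finsum_zero (α := places k K)]
  exact finsum_congr fun w ↦ log_max_one_eq_zero_iff.mpr (places.map_algebraMap_le_one w.2 c)

theorem curveHeight_nonneg (a : K) : 0 ≤ curveHeight k a := by
  refine finsum_nonneg fun w ↦ ?_
  rw [← WithZero.log_one (M := ℤ)]
  exact (WithZero.log_le_log one_ne_zero (zero_lt_one.trans_le (le_max_left _ _)).ne').mpr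
    (le_max_left _ _)

variable [IsAlgClosed k]

theorem transcendental_of_notMem_range_algebraMap {a : K} (ha : a ∉ Set.range (algebraMap k K)) :
    Transcendental k a := by
  intro h
  have : Algebra.IsAlgebraic k k⟮a⟯ := isAlgebraic_adjoin_simple h.isIntegral
  have h1 := mem_adjoin_simple_self k a
  rw [k⟮a⟯.eq_bot_of_isAlgClosed_of_isAlgebraic] at h1
  exact ha (mem_bot.mp h1)

theorem log_max_one_sub_log_max_one_inv {x : WithZero (Multiplicative ℤ)} (hx : x ≠ 0) :
    WithZero.log (max 1 x) - WithZero.log (max 1 x⁻¹) = WithZero.log x := by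
  have hx0 : 0 < x := zero_lt_iff.mpr hx
  rcases le_total x 1 with h | h
  · rw [max_eq_left h, max_eq_right ((one_le_inv₀ hx0).mpr h), WithZero.log_inv]
    simp
  · rw [max_eq_right h, max_eq_left (inv_le_one_of_one_le₀ h)]
    simp

/-- The poles of `a` are the zeros of `a⁻¹`, and `k(a⁻¹) = k(a)`. -/
theorem hasFiniteSupport_and_curveHeight_eq_finrank (hK : IsCurveFunctionField k K) {a : K}
    (ha : Transcendental k a) :
    (fun w : places k K ↦ WithZero.log (max 1 (w.1 a))).HasFiniteSupport ∧
      curveHeight k a = Module.finrank k⟮a⟯ K := by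
  obtain ⟨s, hs, hsK⟩ := hK
  have ha0 : a ≠ 0 := fun h ↦ ha (h ▸ isAlgebraic_zero)
  have ha' : Transcendental k a⁻¹ := fun h ↦ ha (inv_inv a ▸ h.inv)
  have hadj : k⟮a⁻¹⟯ = k⟮a⟯ := le_antisymm
    (adjoin_simple_le_iff.mpr (inv_mem (mem_adjoin_simple_self k a)))
    (adjoin_simple_le_iff.mpr (by simpa using inv_mem (mem_adjoin_simple_self k a⁻¹)))
  have := finiteDimensional_adjoin_of_transcendental hs ha'
  obtain ⟨h1, h2⟩ := zeroPlaces_finite_and_sum ha'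
  have hiff : ∀ w : Valuation K (WithZero (Multiplicative ℤ)), w a⁻¹ < 1 ↔ 1 < w a := fun w ↦ by
    rw [map_inv₀, inv_lt_one₀ (zero_lt_iff.mpr ((w.ne_zero_iff).mpr ha0))]
  have hsupp : ∀ w : Valuation K (WithZero (Multiplicative ℤ)),
      w ∈ Function.support (fun w ↦ WithZero.log (max 1 (w a))) ↔ w a⁻¹ < 1 := fun w ↦ by
    rw [Function.mem_support, Ne, log_max_one_eq_zero_iff, not_le, hiff]
  constructor
  · refine Set.Finite.of_finite_image (f := Subtype.val) (h1.subset ?_)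
      Subtype.val_injective.injOn
    rintro _ ⟨w, hw, rfl⟩
    exact ⟨w.2, (hsupp w.1).mp hw⟩
  · rw [hadj] at h2
    rw [← h2, curveHeight, finsum_set_coe_eq_finsum_mem (places k K)
      (f := fun w ↦ WithZero.log (max 1 (w a))), ← finsum_mem_inter_support]
    refine finsum_mem_congr (Set.ext fun w ↦ and_congr_right fun _ ↦ hsupp w) fun w hw ↦ ?_
    rw [max_eq_right ((hiff w).mp hw.2).le, map_inv₀, WithZero.log_inv, neg_neg]

theorem hasFiniteSupport_log_max_one (hK : IsCurveFunctionField k K) (a : K) :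
    (fun w : places k K ↦ WithZero.log (max 1 (w.1 a))).HasFiniteSupport := by
  by_cases ha : a ∈ Set.range (algebraMap k K)
  · obtain ⟨c, rfl⟩ := ha
    convert! Function.hasFiniteSupport_zero with w
    exact log_max_one_eq_zero_iff.mpr (places.map_algebraMap_le_one w.2 c)
  · exact (hasFiniteSupport_and_curveHeight_eq_finrank hK
      (transcendental_of_notMem_range_algebraMap ha)).1

theorem curveHeight_pos (hK : IsCurveFunctionField k K) {a : K}
    (ha : a ∉ Set.range (algebraMap k K)) : 0 < curveHeight k a := by
  have hat := transcendental_of_notMem_range_algebraMap ha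
  obtain ⟨s, hs, hsK⟩ := id hK
  have := finiteDimensional_adjoin_of_transcendental hs hat
  rw [(hasFiniteSupport_and_curveHeight_eq_finrank hK hat).2]
  exact_mod_cast Module.finrank_pos

theorem curveHeight_inv (hK : IsCurveFunctionField k K) (a : K) :
    curveHeight k a⁻¹ = curveHeight k a := by
  by_cases ha : a ∈ Set.range (algebraMap k K)
  · obtain ⟨c, rfl⟩ := ha
    rw [← map_inv₀, curveHeight_algebraMap, curveHeight_algebraMap]
  · have ha := transcendental_of_notMem_range_algebraMap ha
    have ha' : Transcendental k a⁻¹ := fun h ↦ ha (inv_inv a ▸ h.inv)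
    have hadj : k⟮a⁻¹⟯ = k⟮a⟯ := le_antisymm
      (adjoin_simple_le_iff.mpr (inv_mem (mem_adjoin_simple_self k a)))
      (adjoin_simple_le_iff.mpr (by simpa using inv_mem (mem_adjoin_simple_self k a⁻¹)))
    rw [(hasFiniteSupport_and_curveHeight_eq_finrank hK ha).2,
      (hasFiniteSupport_and_curveHeight_eq_finrank hK ha').2, hadj]

theorem hasFiniteSupport_log (hK : IsCurveFunctionField k K) {a : K} (ha : a ≠ 0) :
    (fun w : places k K ↦ WithZero.log (w.1 a)).HasFiniteSupport := by
  have h := (hasFiniteSupport_log_max_one hK a).fun_sub (hasFiniteSupport_log_max_one hK a⁻¹)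
  convert! h with w
  rw [map_inv₀, log_max_one_sub_log_max_one_inv ((w.1.ne_zero_iff).mpr ha)]

/-- The product formula. -/
theorem finsum_log_eq_zero (hK : IsCurveFunctionField k K) {a : K} (ha : a ≠ 0) :
    ∑ᶠ w : places k K, WithZero.log (w.1 a) = 0 := by
  have h := finsum_sub_distrib (hasFiniteSupport_log_max_one hK a)
    (hasFiniteSupport_log_max_one hK a⁻¹)
  rw [← curveHeight, ← curveHeight, curveHeight_inv hK, sub_self] at h
  rw [← h]
  refine finsum_congr fun w ↦ ?_
  rw [map_inv₀, log_max_one_sub_log_max_one_inv ((w.1.ne_zero_iff).mpr ha)]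

end curveHeight

end

/-! ### Heights in extensions and the Weil height -/

section

open IntermediateField Polynomial
open scoped WithZero

section tower

variable {k F K : Type*} [Field k] [Field F] [Field K] [Algebra k F] [Algebra F K] [Algebra k K]
  [IsScalarTower k F K]

theorem finrank_adjoin_algebraMap (a : F) :
    Module.finrank k⟮algebraMap F K a⟯ K = Module.finrank k⟮a⟯ F * Module.finrank F K := by
  have hmap : k⟮a⟯.map (IsScalarTower.toAlgHom k F K) = k⟮algebraMap F K a⟯ := by
    rw [adjoin_map, Set.image_singleton]
    rfl
  rw [Module.finrank_mul_finrank k⟮a⟯ F K, ← hmap]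
  refine (Algebra.finrank_eq_of_equiv_equiv
    (k⟮a⟯.equivMap (IsScalarTower.toAlgHom k F K)).toRingEquiv (RingEquiv.refl K) ?_).symm
  ext x
  rfl

theorem IsCurveFunctionField.of_finiteDimensional [FiniteDimensional F K]
    (hF : IsCurveFunctionField k F) : IsCurveFunctionField k K := by
  obtain ⟨t, ht, hfin⟩ := hF
  refine ⟨algebraMap F K t, ?_, ?_⟩
  · rwa [transcendental_algebraMap_iff (algebraMap F K).injective]
  · refine Module.finite_of_finrank_pos ?_
    change 0 < Module.finrank k⟮algebraMap F K t⟯ K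
    rw [finrank_adjoin_algebraMap]
    exact Nat.mul_pos (Module.finrank_pos (R := k⟮t⟯)) Module.finrank_pos

/-- In a finite extension the number of poles is multiplied by the degree. -/
theorem curveHeight_algebraMap_eq_finrank_mul [IsAlgClosed k] [FiniteDimensional F K]
    (hF : IsCurveFunctionField k F) (a : F) :
    curveHeight k (algebraMap F K a) = Module.finrank F K * curveHeight k a := by
  by_cases ha : a ∈ Set.range (algebraMap k F)
  · obtain ⟨c, rfl⟩ := ha
    rw [← IsScalarTower.algebraMap_apply, curveHeight_algebraMap, curveHeight_algebraMap, mul_zero]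
  · have hat := transcendental_of_notMem_range_algebraMap ha
    rw [(hasFiniteSupport_and_curveHeight_eq_finrank hF hat).2,
      (hasFiniteSupport_and_curveHeight_eq_finrank (K := K) hF.of_finiteDimensional
        ((transcendental_algebraMap_iff (algebraMap F K).injective).mpr hat)).2,
      finrank_adjoin_algebraMap]
    push_cast
    ring

theorem heightIn_eq_curveHeight_div [IsAlgClosed k] (hK : IsCurveFunctionField k K) (a : K) :
    heightIn k F K a = curveHeight k a / Module.finrank F K := by
  have hset : normalizedPlaces k F K = places k K := by
    simp only [normalizedPlaces, places, IsScalarTower.algebraMap_apply k F K]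
  rw [heightIn, hset, curveHeight]
  congr 1
  have h := (Int.castAddHom ℝ).map_finsum (hasFiniteSupport_log_max_one hK a)
  refine Eq.trans (finsum_congr fun w ↦ ?_) h.symm
  change max (0 : ℝ) ((WithZero.log (w.1 a) : ℤ) : ℝ) = ((WithZero.log (max 1 (w.1 a)) : ℤ) : ℝ)
  rcases eq_or_ne (w.1 a) 0 with h0 | h0
  · simp [h0]
  rcases le_total (w.1 a) 1 with h | h
  · have h1 := (WithZero.log_le_log h0 one_ne_zero).mpr h
    rw [WithZero.log_one] at h1
    rw [max_eq_left h, max_eq_left (by exact_mod_cast h1), WithZero.log_one, Int.cast_zero]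
  · have h1 := (WithZero.log_le_log one_ne_zero h0).mpr h
    rw [WithZero.log_one] at h1
    rw [max_eq_right h, max_eq_right (by exact_mod_cast h1)]

theorem heightIn_algebraMap [IsAlgClosed k] (hF : IsCurveFunctionField k F)
    {M : Type*} [Field M] [Algebra F M] [Algebra k M] [IsScalarTower k F M] [Algebra M K]
    [IsScalarTower F M K] [IsScalarTower k M K] [FiniteDimensional F M] [FiniteDimensional M K]
    (a : M) : heightIn k F K (algebraMap M K a) = heightIn k F M a := by
  have hM : IsCurveFunctionField k M := hF.of_finiteDimensional
  have hK : IsCurveFunctionField k K := hM.of_finiteDimensional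
  rw [heightIn_eq_curveHeight_div hM, heightIn_eq_curveHeight_div hK,
    curveHeight_algebraMap_eq_finrank_mul hM, ← Module.finrank_mul_finrank F M K]
  have h4 : (Module.finrank M K : ℝ) ≠ 0 := Nat.cast_ne_zero.mpr Module.finrank_pos.ne'
  have h5 : (Module.finrank F M : ℝ) ≠ 0 := Nat.cast_ne_zero.mpr Module.finrank_pos.ne'
  push_cast
  field_simp

end tower

/-- The Weil height of an element can be computed in every finite extension of `F` that
contains it. -/
theorem weilHeight_eq_curveHeight_div {k F Fbar : Type*} [Field k] [IsAlgClosed k] [Field F]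
    [Field Fbar] [Algebra k F] [Algebra F Fbar] [Algebra k Fbar] [IsScalarTower k F Fbar]
    (hF : IsCurveFunctionField k F) (L : IntermediateField F Fbar) [FiniteDimensional F L]
    (a : L) : weilHeight k F (a : Fbar) = curveHeight k a / Module.finrank F L := by
  have hle : F⟮(a : Fbar)⟯ ≤ L := adjoin_simple_le_iff.mpr a.2
  let : Algebra F⟮(a : Fbar)⟯ L := (inclusion hle).toRingHom.toAlgebra
  have : IsScalarTower F F⟮(a : Fbar)⟯ L := IsScalarTower.of_algebraMap_eq fun _ ↦ rfl
  have : IsScalarTower k F⟮(a : Fbar)⟯ L := IsScalarTower.of_algebraMap_eq fun _ ↦ rfl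
  have h1 : FiniteDimensional F F⟮(a : Fbar)⟯ := FiniteDimensional.left F _ L
  have h2 : FiniteDimensional F⟮(a : Fbar)⟯ L := FiniteDimensional.right F _ L
  rw [← heightIn_eq_curveHeight_div hF.of_finiteDimensional]
  exact (heightIn_algebraMap hF (K := L) (AdjoinSimple.gen F (a : Fbar))).symm

end

/-! ### Legendre coordinates: local upper bounds -/

/-- The relations between the Legendre coordinates `u₁ = u(P)`, `u₂ = u(Q)`, `u₃ = u(P + Q)` and
`u₄ = u(P - Q)` of points `P ≠ ± Q` on `y² = u (u - 1) (u - l)`. -/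
structure LegendreAdd {K : Type*} [Field K] (l u₁ u₂ u₃ u₄ : K) : Prop where
  ne : u₁ ≠ u₂
  add : (u₃ + u₄) * (u₁ - u₂) ^ 2 = 2 * (u₁ + u₂) * (u₁ * u₂ + l) - 4 * (1 + l) * (u₁ * u₂)
  mul : u₃ * u₄ * (u₁ - u₂) ^ 2 = (u₁ * u₂ - l) ^ 2

/-- The relation between the Legendre coordinates `u = u(P)` and `u' = u(2 P)` of a point `P` with
`2 P ≠ 0` on `y² = u (u - 1) (u - l)`. -/
structure LegendreDouble {K : Type*} [Field K] (l u u' : K) : Prop where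
  ne : 4 * (u * (u - 1) * (u - l)) ≠ 0
  eq : u' * (4 * (u * (u - 1) * (u - l))) = (u ^ 2 - l) ^ 2

section transformations

variable {K : Type*} [Field K] {l u₁ u₂ u₃ u₄ u u' : K}

theorem LegendreAdd.one_sub (h : LegendreAdd l u₁ u₂ u₃ u₄) :
    LegendreAdd (1 - l) (1 - u₁) (1 - u₂) (1 - u₃) (1 - u₄) where
  ne := fun h' ↦ h.ne (by linear_combination -h')
  add := by linear_combination -h.add
  mul := by linear_combination h.mul - h.add

theorem LegendreDouble.one_sub (h : LegendreDouble l u u') :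
    LegendreDouble (1 - l) (1 - u) (1 - u') where
  ne := fun h' ↦ h.ne (by linear_combination -h')
  eq := by linear_combination h.eq

theorem LegendreAdd.div (hl : l ≠ 0) (h : LegendreAdd l u₁ u₂ u₃ u₄) :
    LegendreAdd l⁻¹ (u₁ / l) (u₂ / l) (u₃ / l) (u₄ / l) where
  ne := fun h' ↦ h.ne (by field_simp at h'; exact h')
  add := by
    field_simp
    linear_combination h.add
  mul := by
    field_simp
    linear_combination h.mul

theorem LegendreDouble.div (hl : l ≠ 0) (h : LegendreDouble l u u') :
    LegendreDouble l⁻¹ (u / l) (u' / l) where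
  ne := fun h' ↦ h.ne (by
    field_simp at h'
    linear_combination h')
  eq := by
    field_simp
    linear_combination h.eq

end transformations

section upperBounds

variable {K Γ₀ : Type*} [Field K] [LinearOrderedCommGroupWithZero Γ₀] (w : Valuation K Γ₀)
  {l u₁ u₂ u₃ u₄ u u' : K}

theorem pow_mul_pow_mul_pow_le {a b c : Γ₀} (ha : 1 ≤ a) (hb : 1 ≤ b) (hc : 1 ≤ c)
    {i j k i' j' k' : ℕ} (hi : i ≤ i') (hj : j ≤ j') (hk : k ≤ k') :
    a ^ i * b ^ j * c ^ k ≤ a ^ i' * b ^ j' * c ^ k' :=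
  mul_le_mul' (mul_le_mul' (pow_le_pow_right' ha hi) (pow_le_pow_right' hb hj))
    (pow_le_pow_right' hc hk)

/-- A nonarchimedean bound for a pair in terms of its elementary symmetric functions. -/
theorem Valuation.max_one_mul_max_one_le (a b : K) :
    max 1 (w a) * max 1 (w b) ≤ max 1 (max (w (a + b)) (w (a * b))) := by
  rcases le_or_gt (w a) 1 with ha | ha <;> rcases le_or_gt (w b) 1 with hb | hb
  · simp [max_eq_left ha, max_eq_left hb]
  · rw [max_eq_left ha, max_eq_right hb.le, one_mul,
      Valuation.map_add_eq_of_lt_right w (ha.trans_lt hb)]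
    exact (le_max_left _ _).trans (le_max_right _ _)
  · rw [max_eq_left hb, max_eq_right ha.le, mul_one,
      Valuation.map_add_eq_of_lt_left w (hb.trans_lt ha)]
    exact (le_max_left _ _).trans (le_max_right _ _)
  · rw [max_eq_right ha.le, max_eq_right hb.le, ← map_mul]
    exact (le_max_right _ _).trans (le_max_right _ _)

theorem Valuation.map_ofNat_mul_le (n : ℕ) [n.AtLeastTwo] (a : K) :
    w (OfNat.ofNat n * a) ≤ w a := by
  have h : ∀ n : ℕ, w (n : K) ≤ 1 := fun n ↦ by
    induction n with
    | zero => simp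
    | succ n ih =>
      rw [Nat.cast_succ]
      exact w.map_add_le ih w.map_one.le
  rw [map_mul]
  exact mul_le_of_le_one_left' (h n)

/-- The local form of `h(P + Q) + h(P - Q) ≤ 2 h(P) + 2 h(Q) + O(1)`. The factor `w (u₁ - u₂) ^ 2`
clears the denominators and disappears in the sum over all places. -/
theorem LegendreAdd.max_one_mul_max_one_le (h : LegendreAdd l u₁ u₂ u₃ u₄) :
    max 1 (w u₃) * max 1 (w u₄) * w (u₁ - u₂) ^ 2 ≤
      max 1 (w l) ^ 2 * max 1 (w u₁) ^ 2 * max 1 (w u₂) ^ 2 := by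
  obtain ⟨a, ha⟩ : ∃ a, a = max 1 (w l) := ⟨_, rfl⟩
  obtain ⟨b, hb⟩ : ∃ b, b = max 1 (w u₁) := ⟨_, rfl⟩
  obtain ⟨c, hc⟩ : ∃ c, c = max 1 (w u₂) := ⟨_, rfl⟩
  rw [← ha, ← hb, ← hc]
  have ha1 : 1 ≤ a := ha ▸ le_max_left _ _
  have hb1 : 1 ≤ b := hb ▸ le_max_left _ _
  have hc1 : 1 ≤ c := hc ▸ le_max_left _ _
  have hla : w l ≤ a := ha ▸ le_max_right _ _
  have hub : w u₁ ≤ b := hb ▸ le_max_right _ _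
  have huc : w u₂ ≤ c := hc ▸ le_max_right _ _
  have hbc : b ≤ b * c := le_mul_of_one_le_right' hc1
  have hcb : c ≤ b * c := le_mul_of_one_le_left' hb1
  have h12 : w (u₁ * u₂) ≤ b * c := (map_mul w _ _).trans_le (mul_le_mul' hub huc)
  have hbca : b * c ≤ a * b * c := by
    simpa using pow_mul_pow_mul_pow_le ha1 hb1 hc1 (zero_le_one) (le_refl 1) (le_refl 1)
  have haabc : a ≤ a * b * c := by
    simpa using pow_mul_pow_mul_pow_le ha1 hb1 hc1 (le_refl 1) (zero_le_one) (zero_le_one)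
  have h1l : w (1 + l) ≤ a := w.map_add_le (w.map_one.trans_le ha1) hla
  calc max 1 (w u₃) * max 1 (w u₄) * w (u₁ - u₂) ^ 2
      ≤ max 1 (max (w (u₃ + u₄)) (w (u₃ * u₄))) * w (u₁ - u₂) ^ 2 := by
        gcongr; exact w.max_one_mul_max_one_le u₃ u₄
    _ = max (w (u₁ - u₂) ^ 2) (max (w (2 * (u₁ + u₂) * (u₁ * u₂ + l) - 4 * (1 + l) * (u₁ * u₂)))
          (w (u₁ * u₂ - l) ^ 2)) := by
        rw [← max_mul_mul_right, ← max_mul_mul_right, one_mul, ← map_pow w,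
          ← map_mul, ← map_mul, h.add, h.mul,
          map_pow w (u₁ * u₂ - l)]
    _ ≤ a ^ 2 * b ^ 2 * c ^ 2 := by
        refine max_le ?_ (max_le (w.map_sub_le ?_ ?_) ?_)
        · calc w (u₁ - u₂) ^ 2 ≤ (b * c) ^ 2 :=
                pow_le_pow_left' (w.map_sub_le (hub.trans hbc) (huc.trans hcb)) 2
            _ ≤ (a * b * c) ^ 2 := pow_le_pow_left' hbca 2
            _ = a ^ 2 * b ^ 2 * c ^ 2 := by rw [mul_pow, mul_pow]
        · rw [mul_assoc]
          refine (w.map_ofNat_mul_le 2 _).trans ?_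
          rw [map_mul]
          calc w (u₁ + u₂) * w (u₁ * u₂ + l) ≤ (b * c) * (a * b * c) :=
                mul_le_mul' (w.map_add_le (hub.trans hbc) (huc.trans hcb))
                  (w.map_add_le (h12.trans hbca) (hla.trans haabc))
            _ ≤ (a * b * c) * (a * b * c) := by gcongr
            _ = a ^ 2 * b ^ 2 * c ^ 2 := by rw [← pow_two, mul_pow, mul_pow]
        · rw [mul_assoc]
          refine (w.map_ofNat_mul_le 4 _).trans ?_
          rw [map_mul]
          calc w (1 + l) * w (u₁ * u₂) ≤ a * (b * c) := mul_le_mul' h1l h12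
            _ = a ^ 1 * b ^ 1 * c ^ 1 := by simp [mul_assoc]
            _ ≤ a ^ 2 * b ^ 2 * c ^ 2 :=
                pow_mul_pow_mul_pow_le ha1 hb1 hc1 one_le_two one_le_two one_le_two
        · calc w (u₁ * u₂ - l) ^ 2 ≤ (a * b * c) ^ 2 :=
                pow_le_pow_left' (w.map_sub_le (h12.trans hbca) (hla.trans haabc)) 2
            _ = a ^ 2 * b ^ 2 * c ^ 2 := by rw [mul_pow, mul_pow]

/-- The local form of `h(2 P) ≤ 4 h(P) + O(1)`. -/
theorem LegendreDouble.max_one_mul_le (h : LegendreDouble l u u') :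
    max 1 (w u') * w (4 * (u * (u - 1) * (u - l))) ≤ max 1 (w l) ^ 2 * max 1 (w u) ^ 4 := by
  obtain ⟨a, ha⟩ : ∃ a, a = max 1 (w l) := ⟨_, rfl⟩
  obtain ⟨b, hb⟩ : ∃ b, b = max 1 (w u) := ⟨_, rfl⟩
  rw [← ha, ← hb]
  have ha1 : 1 ≤ a := ha ▸ le_max_left _ _
  have hb1 : 1 ≤ b := hb ▸ le_max_left _ _
  have hla : w l ≤ a := ha ▸ le_max_right _ _
  have hub : w u ≤ b := hb ▸ le_max_right _ _
  have hbab : b ≤ a * b := le_mul_of_one_le_left' ha1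
  have haab : a ≤ a * b := le_mul_of_one_le_right' hb1
  rw [← max_mul_mul_right, one_mul, ← map_mul, h.eq, map_pow]
  refine max_le ((w.map_ofNat_mul_le 4 _).trans ?_) ?_
  · rw [map_mul, map_mul]
    calc w u * w (u - 1) * w (u - l) ≤ b * b * (a * b) :=
          mul_le_mul' (mul_le_mul' hub (w.map_sub_le hub (w.map_one.trans_le hb1)))
            (w.map_sub_le (hub.trans hbab) (hla.trans haab))
      _ = a ^ 1 * b ^ 3 * 1 ^ 1 := by rw [one_pow, mul_one, pow_one, pow_succ, pow_two]; ac_rfl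
      _ ≤ a ^ 2 * b ^ 4 * 1 ^ 1 :=
          pow_mul_pow_mul_pow_le ha1 hb1 le_rfl one_le_two (by norm_num) le_rfl
      _ = a ^ 2 * b ^ 4 := by simp
  · calc w (u ^ 2 - l) ^ 2 ≤ (a * b ^ 2) ^ 2 := by
          refine pow_le_pow_left' (w.map_sub_le ?_ ?_) 2
          · rw [map_pow]
            exact (pow_le_pow_left' hub 2).trans (le_mul_of_one_le_left' ha1)
          · exact hla.trans (le_mul_of_one_le_right' (one_le_pow_of_one_le' hb1 2))
      _ = a ^ 2 * b ^ 4 := by rw [mul_pow, ← pow_mul]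

/-- The local form of `4 h(P) ≤ h(2 P) + O(1)`. The numerators of the differences of `u'` with `0`,
`1` and `l` are squares of quadratic polynomials in `u` that span all quadratic polynomials. -/
theorem LegendreDouble.le_max_one_mul (h2 : w 2 = 1) (h : LegendreDouble l u u') :
    w (l * (l - 1)) ^ 2 * max 1 (w u) ^ 4 ≤
      max 1 (w l) ^ 5 * max 1 (w u') * w (4 * (u * (u - 1) * (u - l))) := by
  obtain ⟨a, ha⟩ : ∃ a, a = max 1 (w l) := ⟨_, rfl⟩
  obtain ⟨b, hb⟩ : ∃ b, b = max 1 (w u') := ⟨_, rfl⟩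
  obtain ⟨g, hg⟩ : ∃ g, g = w (4 * (u * (u - 1) * (u - l))) := ⟨_, rfl⟩
  rw [← ha, ← hb, ← hg]
  have ha1 : 1 ≤ a := ha ▸ le_max_left _ _
  have hb1 : 1 ≤ b := hb ▸ le_max_left _ _
  have hla : w l ≤ a := ha ▸ le_max_right _ _
  have hub : w u' ≤ b := hb ▸ le_max_right _ _
  have hl1 : w (l - 1) ≤ a := w.map_sub_le hla (w.map_one.trans_le ha1)
  obtain ⟨q₁, hq₁⟩ : ∃ q, q = u ^ 2 - l := ⟨_, rfl⟩
  obtain ⟨q₂, hq₂⟩ : ∃ q, q = u ^ 2 - 2 * u + l := ⟨_, rfl⟩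
  obtain ⟨q₃, hq₃⟩ : ∃ q, q = u ^ 2 - 2 * l * u + l := ⟨_, rfl⟩
  obtain ⟨Q, hQ⟩ : ∃ Q, Q = max (w q₁) (max (w q₂) (w q₃)) := ⟨_, rfl⟩
  have h1Q : w q₁ ≤ Q := hQ ▸ le_max_left _ _
  have h2Q : w q₂ ≤ Q := hQ ▸ (le_max_left _ _).trans (le_max_right _ _)
  have h3Q : w q₃ ≤ Q := hQ ▸ (le_max_right _ _).trans (le_max_right _ _)
  have hQ2 : Q ^ 2 ≤ a * b * g := by
    have e₁ : w q₁ ^ 2 = w u' * g := by rw [hg, ← map_pow, ← map_mul, h.eq, hq₁]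
    have e₂ : w q₂ ^ 2 = w (u' - 1) * g := by
      rw [hg, ← map_pow, ← map_mul, hq₂]
      congr 1
      linear_combination -h.eq
    have e₃ : w q₃ ^ 2 = w (u' - l) * g := by
      rw [hg, ← map_pow, ← map_mul, hq₃]
      congr 1
      linear_combination -h.eq
    have hbab : b ≤ a * b := le_mul_of_one_le_left' ha1
    have haab : a ≤ a * b := le_mul_of_one_le_right' hb1
    have hle : ∀ x, w x ≤ a * b → w x * g ≤ a * b * g := fun x hx ↦ by gcongr
    rw [hQ]
    rcases max_choice (w q₁) (max (w q₂) (w q₃)) with h' | h' <;> rw [h']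
    · exact e₁ ▸ hle _ (hub.trans hbab)
    rcases max_choice (w q₂) (w q₃) with h' | h' <;> rw [h']
    · exact e₂ ▸ hle _ (w.map_sub_le (hub.trans hbab) ((w.map_one.trans_le ha1).trans haab))
    · exact e₃ ▸ hle _ (w.map_sub_le (hub.trans hbab) (hla.trans haab))
  have hd : w (l * (l - 1)) ≤ a * Q := by
    have e : 2 * (l * (l - 1)) = (q₂ - q₃) - (l - 1) * (q₁ - q₂) := by
      rw [hq₁, hq₂, hq₃]; ring
    calc w (l * (l - 1)) = w (2 * (l * (l - 1))) := by rw [map_mul w 2, h2, one_mul]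
      _ ≤ a * Q := by
        rw [e]
        refine w.map_sub_le ((w.map_sub_le h2Q h3Q).trans (le_mul_of_one_le_left' ha1)) ?_
        rw [map_mul]
        exact mul_le_mul' hl1 (w.map_sub_le h1Q h2Q)
  have hd' : w (l * (l - 1)) ≤ a ^ 2 := by
    rw [map_mul, pow_two]; exact mul_le_mul' hla hl1
  have hu2 : w (l * (l - 1)) * w u ^ 2 ≤ a ^ 2 * Q := by
    rw [← map_pow, ← map_mul, show l * (l - 1) * u ^ 2 = l * (l - 1) * q₁ + l * (l * (l - 1)) by
      rw [hq₁]; ring]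
    refine w.map_add_le ?_ ?_
    · rw [map_mul]; exact mul_le_mul' hd' h1Q
    · rw [map_mul, pow_two, mul_assoc]; exact mul_le_mul' hla hd
  have hm : w (l * (l - 1)) * max 1 (w u) ^ 2 ≤ a ^ 2 * Q := by
    rcases max_choice 1 (w u) with h' | h' <;> rw [h']
    · rw [one_pow, mul_one]
      exact hd.trans (by gcongr; exact le_self_pow ha1 two_ne_zero)
    · exact hu2
  calc w (l * (l - 1)) ^ 2 * max 1 (w u) ^ 4 = (w (l * (l - 1)) * max 1 (w u) ^ 2) ^ 2 := by
        rw [mul_pow, ← pow_mul]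
    _ ≤ (a ^ 2 * Q) ^ 2 := pow_le_pow_left' hm 2
    _ = a ^ 4 * Q ^ 2 := by rw [mul_pow, ← pow_mul]
    _ ≤ a ^ 4 * (a * b * g) := by gcongr
    _ = a ^ 5 * b * g := by rw [pow_succ a 4]; ac_rfl

end upperBounds

/-! ### Legendre coordinates: multiplicative reduction -/

section nonsingularReduction

variable {K Γ₀ : Type*} [Field K] [LinearOrderedCommGroupWithZero Γ₀] {w : Valuation K Γ₀}
  {l u₁ u₂ u₃ u₄ u u' : K}

theorem Valuation.map_two_mul (h2 : w 2 = 1) (a : K) : w (2 * a) = w a := by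
  rw [map_mul, h2, one_mul]

theorem Valuation.map_four_mul (h2 : w 2 = 1) (a : K) : w (4 * a) = w a := by
  rw [show (4 : K) * a = 2 * (2 * a) by ring, map_two_mul h2, map_two_mul h2]

/-- Doubling when `w l < 1` and `P` does not reduce to the node `u = 0`: numerator and denominator
of the duplication formula have no common factor. -/
theorem LegendreDouble.eq_pow_four_of_map_lt_one (h2 : w 2 = 1) (hl : w l < 1) (hu : 1 ≤ w u)
    (h : LegendreDouble l u u') :
    1 ≤ w u' ∧ w u' * w (4 * (u * (u - 1) * (u - l))) = w u ^ 4 := by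
  have hlu : w l < w u := hl.trans_le hu
  have hlu2 : w l < w (u ^ 2) := by
    rw [map_pow]
    exact hlu.trans_le (le_self_pow hu two_ne_zero)
  have hnum : w u' * w (4 * (u * (u - 1) * (u - l))) = w u ^ 4 := by
    rw [← map_mul, h.eq, map_pow, Valuation.map_sub_eq_of_lt_left w hlu2, map_pow, ← pow_mul]
  refine ⟨?_, hnum⟩
  by_contra! h'
  have hden : w (4 * (u * (u - 1) * (u - l))) ≤ w u ^ 3 := by
    rw [w.map_four_mul h2, map_mul, map_mul, Valuation.map_sub_eq_of_lt_left w hlu, pow_succ,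
      pow_two]
    gcongr
    exact w.map_sub_le le_rfl (w.map_one.trans_le hu)
  have hpos : 0 < w (4 * (u * (u - 1) * (u - l))) := zero_lt_iff.mpr ((w.ne_zero_iff).mpr h.ne)
  have h1 : w u ^ 4 < w u ^ 4 := calc
    w u ^ 4 = w u' * w (4 * (u * (u - 1) * (u - l))) := hnum.symm
    _ < 1 * w (4 * (u * (u - 1) * (u - l))) := mul_lt_mul_of_pos_right h' hpos
    _ ≤ w u ^ 3 := by rwa [one_mul]
    _ ≤ w u ^ 4 := pow_le_pow_right' hu (by norm_num)
  exact lt_irrefl _ h1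

/-- Doubling at a place of good reduction. -/
theorem LegendreDouble.max_one_mul_eq_of_map_eq_one (h2 : w 2 = 1) (hl : w l = 1)
    (hl1 : w (1 - l) = 1) (h : LegendreDouble l u u') :
    max 1 (w u') * w (4 * (u * (u - 1) * (u - l))) = max 1 (w u) ^ 4 := by
  rw [← max_mul_mul_right, one_mul, ← map_mul, h.eq, map_pow, w.map_four_mul h2, map_mul, map_mul]
  rcases le_or_gt (w u) 1 with hu | hu
  · rw [max_eq_left hu, one_pow]
    have hu1 : w (u - 1) ≤ 1 := w.map_sub_le hu w.map_one.le
    have hul : w (u - l) ≤ 1 := w.map_sub_le hu hl.le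
    have hq : w (u ^ 2 - l) ≤ 1 := w.map_sub_le ((map_pow w u 2).trans_le (pow_le_one' hu 2)) hl.le
    refine le_antisymm (max_le (mul_le_one' (mul_le_one' hu hu1) hul) (pow_le_one' hq 2)) ?_
    rcases hq.eq_or_lt with hq | hq
    · rw [hq, one_pow]; exact le_max_right _ _
    refine le_trans ?_ (le_max_left _ _)
    have key : ∀ a b : K, u ^ 2 - l = a + b → w a < 1 → w b = 1 → False := fun a b e ha hb ↦ by
      rw [e, Valuation.map_add_eq_of_lt_right w (ha.trans_eq hb.symm), hb] at hq
      exact lt_irrefl _ hq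
    -- `u ^ 2 - l` is a unit at each of the three zeros of the denominator modulo the place
    have e1 : w u = 1 := by
      refine le_antisymm hu (not_lt.mp fun hlt ↦ key (u ^ 2) (-l) (by ring) ?_ ?_)
      · rw [map_pow]; exact pow_lt_one' hlt two_ne_zero
      · rw [Valuation.map_neg, hl]
    have e2 : w (u - 1) = 1 := by
      refine le_antisymm hu1 (not_lt.mp fun hlt ↦
        key ((u - 1) * (u + 1)) (1 - l) (by ring) ?_ hl1)
      rw [map_mul]
      exact (mul_le_of_le_one_right' (w.map_add_le hu w.map_one.le)).trans_lt hlt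
    have e3 : w (u - l) = 1 := by
      refine le_antisymm hul (not_lt.mp fun hlt ↦
        key ((u - l) * (u + l)) (-(l * (1 - l))) (by ring) ?_ ?_)
      · rw [map_mul]
        exact (mul_le_of_le_one_right' (w.map_add_le hu hl.le)).trans_lt hlt
      · rw [Valuation.map_neg, map_mul, hl, hl1, one_mul]
    rw [e1, e2, e3, one_mul, one_mul]
  · have hlu : w l < w u := hl.trans_lt hu
    have hlu2 : w l < w (u ^ 2) := by
      rw [map_pow]
      exact hlu.trans_le (le_self_pow hu.le two_ne_zero)
    rw [max_eq_right hu.le, Valuation.map_sub_eq_of_lt_left w hlu2,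
      Valuation.map_sub_eq_of_lt_left w hlu,
      Valuation.map_sub_eq_of_lt_left w (w.map_one.trans_lt hu), map_pow, ← pow_mul, ← pow_two,
      ← pow_succ]
    exact max_eq_right (pow_le_pow_right' hu.le (by norm_num))

/-- For `w l < 1`, the sum of two points that do not reduce to the node does not either; the
same holds for their difference. -/
theorem LegendreAdd.one_le_of_one_le (hl : w l < 1) (h1 : 1 ≤ w u₁) (h2 : 1 ≤ w u₂)
    (h : LegendreAdd l u₁ u₂ u₃ u₄) : 1 ≤ w u₃ ∧ 1 ≤ w u₄ := by
  have hd0 : 0 < w (u₁ - u₂) ^ 2 := pow_pos (zero_lt_iff.mpr ((w.ne_zero_iff).mpr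
    (sub_ne_zero.mpr h.ne))) 2
  have h1P : w u₁ ≤ w u₁ * w u₂ := le_mul_of_one_le_right' h2
  have h2P : w u₂ ≤ w u₁ * w u₂ := le_mul_of_one_le_left' h1
  have hd : w (u₁ - u₂) ^ 2 ≤ (w u₁ * w u₂) ^ 2 := pow_le_pow_left' (w.map_sub_le h1P h2P) 2
  have hP1 : 1 ≤ w u₁ * w u₂ := h1.trans h1P
  have hmul : w u₃ * w u₄ * w (u₁ - u₂) ^ 2 = (w u₁ * w u₂) ^ 2 := by
    rw [← map_mul w u₃, ← map_pow, ← map_mul, h.mul, map_pow,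
      Valuation.map_sub_eq_of_lt_left w (by rw [map_mul]; exact hl.trans_le hP1), map_mul]
  have hadd : w (u₃ + u₄) * w (u₁ - u₂) ^ 2 ≤ (w u₁ * w u₂) ^ 2 := by
    have hsum : w (u₁ + u₂) ≤ w u₁ * w u₂ := w.map_add_le h1P h2P
    have hprod : w (u₁ * u₂ + l) ≤ w u₁ * w u₂ :=
      w.map_add_le (map_mul w _ _).le (hl.le.trans hP1)
    rw [← map_pow, ← map_mul, h.add, pow_two]
    refine w.map_sub_le ?_ ?_
    · rw [mul_assoc]
      refine (w.map_ofNat_mul_le 2 _).trans ?_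
      rw [map_mul]
      exact mul_le_mul' hsum hprod
    · rw [mul_assoc]
      refine (w.map_ofNat_mul_le 4 _).trans ?_
      rw [map_mul, map_mul w u₁]
      exact mul_le_mul' ((w.map_add_le w.map_one.le hl.le).trans hP1) le_rfl
  -- if one of the two values were small, the other one would be too large for the sum
  have key : ∀ a b : K, w a * w b * w (u₁ - u₂) ^ 2 = (w u₁ * w u₂) ^ 2 →
      w (a + b) * w (u₁ - u₂) ^ 2 ≤ (w u₁ * w u₂) ^ 2 → 1 ≤ w a := by
    intro a b hm ha
    by_contra! hlt
    have hb : 1 < w b := by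
      by_contra! hb
      have : w a * w b * w (u₁ - u₂) ^ 2 < 1 * w (u₁ - u₂) ^ 2 :=
        mul_lt_mul_of_pos_right ((mul_le_of_le_one_right' hb).trans_lt hlt) hd0
      rw [hm, one_mul] at this
      exact absurd this (not_lt.mpr hd)
    rw [Valuation.map_add_eq_of_lt_right w (hlt.trans hb)] at ha
    have : w a * (w b * w (u₁ - u₂) ^ 2) < 1 * (w b * w (u₁ - u₂) ^ 2) :=
      mul_lt_mul_of_pos_right hlt (mul_pos (zero_lt_one.trans hb) hd0)
    rw [← mul_assoc, hm, one_mul] at this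
    exact absurd this (not_lt.mpr ha)
  exact ⟨key u₃ u₄ hmul hadd, key u₄ u₃ (by rw [mul_comm (w u₄), hmul]) (by rwa [add_comm])⟩

/-- For `w l < 1`, two points that reduce to the node and have the same invariant
`max |u| |l|` lie, up to sign, on the same component: their sum or their difference does not
reduce to the node. -/
theorem LegendreAdd.one_le_or_one_le (h2 : w 2 = 1) (hl0 : l ≠ 0) (hl : w l < 1) (hu₁ : w u₁ < 1)
    (he : max (w u₁) (w l) = max (w u₂) (w l))
    (h : LegendreAdd l u₁ u₂ u₃ u₄) : 1 ≤ w u₃ ∨ 1 ≤ w u₄ := by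
  have hd0 : 0 < w (u₁ - u₂) ^ 2 := pow_pos (zero_lt_iff.mpr ((w.ne_zero_iff).mpr
    (sub_ne_zero.mpr h.ne))) 2
  by_contra! hlt
  rcases le_or_gt (w u₁) (w l) with hle | hgt
  · -- the component opposite to the identity component
    have hle2 : w u₂ ≤ w l := by
      rw [max_eq_right hle] at he
      exact he ▸ le_max_left _ _
    have hl0' : 0 < w l := zero_lt_iff.mpr ((w.ne_zero_iff).mpr hl0)
    have hprod : w (u₁ * u₂) < w l := by
      rw [map_mul]
      calc w u₁ * w u₂ ≤ w l * w l := mul_le_mul' hle hle2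
        _ < 1 * w l := mul_lt_mul_of_pos_right hl hl0'
        _ = w l := one_mul _
    have hmul := congrArg w h.mul
    rw [map_mul, map_pow, map_pow, Valuation.map_sub_eq_of_lt_right w hprod] at hmul
    have h1 : w (u₃ * u₄) < 1 := by
      rw [map_mul]
      exact (mul_le_of_le_one_right' hlt.2.le).trans_lt hlt.1
    have h3 := mul_lt_mul_of_pos_right h1 hd0
    rw [hmul, one_mul] at h3
    exact absurd h3 (not_lt.mpr (pow_le_pow_left' (w.map_sub_le hle hle2) 2))
  · have hpos : 0 < w u₁ := (zero_le (a := w l)).trans_lt hgt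
    have he2 : w u₂ = w u₁ := by
      rw [max_eq_left hgt.le] at he
      rcases max_choice (w u₂) (w l) with h' | h' <;> rw [h'] at he
      · exact he.symm
      · exact absurd he hgt.ne'
    have hsum : w (u₁ + u₂) ≤ w u₁ := w.map_add_le le_rfl he2.le
    -- the term `4 u₁ u₂` dominates the sum
    have hS : w (2 * ((u₁ + u₂) * (u₁ * u₂) + (u₁ + u₂) * l - 2 * (l * (u₁ * u₂)))) <
        w (4 * (u₁ * u₂)) := by
      rw [w.map_four_mul h2, w.map_two_mul h2, map_mul w u₁, he2]
      refine w.map_sub_lt (w.map_add_lt ?_ ?_) ?_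
      · rw [map_mul, map_mul w u₁, he2]
        calc w (u₁ + u₂) * (w u₁ * w u₁) ≤ w u₁ * (w u₁ * w u₁) := by gcongr
          _ < 1 * (w u₁ * w u₁) := mul_lt_mul_of_pos_right hu₁ (mul_pos hpos hpos)
          _ = w u₁ * w u₁ := one_mul _
      · rw [map_mul]
        calc w (u₁ + u₂) * w l ≤ w u₁ * w l := by gcongr
          _ < w u₁ * w u₁ := mul_lt_mul_of_pos_left hgt hpos
      · rw [w.map_two_mul h2, map_mul, map_mul w u₁, he2]
        calc w l * (w u₁ * w u₁) < 1 * (w u₁ * w u₁) :=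
              mul_lt_mul_of_pos_right hl (mul_pos hpos hpos)
          _ = w u₁ * w u₁ := one_mul _
    have hadd := congrArg w h.add
    rw [show 2 * (u₁ + u₂) * (u₁ * u₂ + l) - 4 * (1 + l) * (u₁ * u₂) =
      2 * ((u₁ + u₂) * (u₁ * u₂) + (u₁ + u₂) * l - 2 * (l * (u₁ * u₂))) - 4 * (u₁ * u₂) by ring,
      Valuation.map_sub_eq_of_lt_right w hS, w.map_four_mul h2, map_mul, map_pow, map_mul w u₁, he2,
      ← pow_two] at hadd
    have h3 := mul_lt_mul_of_pos_right (w.map_add_lt hlt.1 hlt.2) hd0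
    rw [hadd, one_mul] at h3
    exact absurd h3 (not_lt.mpr (pow_le_pow_left' (w.map_sub_le le_rfl he2.le) 2))

end nonsingularReduction

/-! ### Multiples of a point with nonsingular reduction -/

section

open scoped WithZero

/-- The Legendre coordinates `a n = u(n P)`, `n > 0`, of the multiples of a point of infinite
order. -/
structure LegendreSeq {K : Type*} [Field K] (l : K) (a : ℕ → K) : Prop where
  double : ∀ n, 0 < n → LegendreDouble l (a n) (a (2 * n))
  add : ∀ m n, 0 < n → n < m → LegendreAdd l (a m) (a n) (a (m + n)) (a (m - n))

theorem LegendreSeq.one_sub {K : Type*} [Field K] {l : K} {a : ℕ → K} (h : LegendreSeq l a) :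
    LegendreSeq (1 - l) fun n ↦ 1 - a n :=
  ⟨fun n hn ↦ (h.double n hn).one_sub, fun m n hn hmn ↦ (h.add m n hn hmn).one_sub⟩

theorem LegendreSeq.div {K : Type*} [Field K] {l : K} {a : ℕ → K} (hl : l ≠ 0)
    (h : LegendreSeq l a) : LegendreSeq l⁻¹ fun n ↦ a n / l :=
  ⟨fun n hn ↦ (h.double n hn).div hl, fun m n hn hmn ↦ (h.add m n hn hmn).div hl⟩

section localTheory

variable {K : Type*} [Field K] {w : Valuation K (WithZero (Multiplicative ℤ))} {l : K} {a : ℕ → K}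

/-- For `w l < 1`, the points that do not reduce to the node form a subgroup. -/
theorem LegendreSeq.one_le_mul (h : LegendreSeq l a) (h2 : w 2 = 1) (hl : w l < 1) {n : ℕ}
    (hn : 0 < n) (ha : 1 ≤ w (a n)) {j : ℕ} (hj : 0 < j) : 1 ≤ w (a (n * j)) := by
  induction j, hj using Nat.le_induction with
  | base => simpa using ha
  | succ j hj ih =>
    rcases hj.eq_or_lt with rfl | hj'
    · rw [mul_comm n]
      exact ((h.double n hn).eq_pow_four_of_map_lt_one h2 hl ha).1
    · exact ((h.add (n * j) n hn (lt_mul_of_one_lt_right hn hj')).one_le_of_one_le hl ih ha).1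

/-- Some positive multiple does not reduce to the node: a pigeonhole argument over the finitely many
possible values of `max |a n| |l|`, which stand for the components of the special fiber up to
sign. -/
theorem LegendreSeq.exists_one_le (h : LegendreSeq l a) (h2 : w 2 = 1) (hl0 : l ≠ 0)
    (hl : w l < 1) : ∃ n, 0 < n ∧ 1 ≤ w (a n) := by
  by_contra! hlt
  have hl0' : w l ≠ 0 := (w.ne_zero_iff).mpr hl0
  have hne : ∀ n, max (w (a (n + 1))) (w l) ≠ 0 := fun n ↦
    ((zero_lt_iff.mpr hl0').trans_le (le_max_right _ _)).ne'
  obtain ⟨n, m, hnm, he⟩ := Set.Finite.exists_lt_map_eq_of_forall_mem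
    (f := fun n : ℕ ↦ WithZero.log (max (w (a (n + 1))) (w l)))
    (t := Set.Icc (WithZero.log (w l)) 0) (fun n ↦ by
      constructor
      · exact (WithZero.log_le_log hl0' (hne n)).mpr (le_max_right _ _)
      · rw [← WithZero.log_one (M := ℤ)]
        exact (WithZero.log_le_log (hne n) one_ne_zero).mpr
          (max_le (hlt _ n.succ_pos).le hl.le)) (Set.finite_Icc _ _)
  have he' : max (w (a (m + 1))) (w l) = max (w (a (n + 1))) (w l) := by
    rw [← WithZero.exp_log (hne m), ← WithZero.exp_log (hne n)]
    exact congrArg _ he.symm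
  rcases (h.add (m + 1) (n + 1) n.succ_pos (by omega)).one_le_or_one_le h2 hl0 hl
    (hlt _ m.succ_pos) he' with h' | h'
  · exact absurd h' (not_le.mpr (hlt _ (by omega)))
  · exact absurd h' (not_le.mpr (hlt _ (by omega)))

/-- The point with Legendre coordinate `u` has nonsingular reduction at `w`, on the model that is
obtained from `y² = u (u - 1) (u - l)` by a permutation of the `2`-torsion points and a quadratic
twist and is semistable at `w`. The three conditions concern the node of the reduction when `l`
reduces to `0`, `1` or `∞`; in all other cases the reduction is good. -/
def NonsingularReduction {K : Type*} [Field K] (w : Valuation K (WithZero (Multiplicative ℤ)))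
    (l u : K) : Prop :=
  (w l < 1 → 1 ≤ w u) ∧ (w (1 - l) < 1 → 1 ≤ w (1 - u)) ∧ (w l⁻¹ < 1 → 1 ≤ w (u / l))

theorem NonsingularReduction.of_map_eq_one (hl : w l = 1) (hl1 : w (1 - l) = 1) (u : K) :
    NonsingularReduction w l u :=
  ⟨fun h ↦ absurd hl h.ne, fun h ↦ absurd hl1 h.ne, fun h ↦ absurd hl (by
    rw [map_inv₀] at h
    intro h'
    rw [h', inv_one] at h
    exact lt_irrefl _ h)⟩

theorem LegendreSeq.exists_nonsingularReduction (h : LegendreSeq l a) (h2 : w 2 = 1) (hl0 : l ≠ 0)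
    (hl1 : l ≠ 1) : ∃ n, 0 < n ∧ ∀ j, 0 < j → NonsingularReduction w l (a (n * j)) := by
  have hl1' : 1 - l ≠ 0 := sub_ne_zero.mpr hl1.symm
  have hinv : w l⁻¹ < 1 ↔ 1 < w l := by
    rw [map_inv₀, inv_lt_one₀ (zero_lt_iff.mpr ((w.ne_zero_iff).mpr hl0))]
  rcases lt_trichotomy (w l) 1 with hl | hl | hl
  · obtain ⟨n, hn, ha⟩ := h.exists_one_le h2 hl0 hl
    refine ⟨n, hn, fun j hj ↦ ⟨fun _ ↦ h.one_le_mul h2 hl hn ha hj, fun h' ↦ ?_, fun h' ↦ ?_⟩⟩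
    · rw [w.map_one_sub_of_lt hl] at h'
      exact absurd h' (lt_irrefl _)
    · exact absurd (hinv.mp h') (not_lt.mpr hl.le)
  · rcases (w.map_sub_le w.map_one.le hl.le : w (1 - l) ≤ 1).lt_or_eq with h1 | h1
    · obtain ⟨n, hn, ha⟩ := h.one_sub.exists_one_le h2 hl1' h1
      refine ⟨n, hn, fun j hj ↦ ⟨fun h' ↦ absurd hl h'.ne,
        fun _ ↦ h.one_sub.one_le_mul h2 h1 hn ha hj, fun h' ↦ ?_⟩⟩
      exact absurd hl (hinv.mp h').ne'
    · exact ⟨1, one_pos, fun j _ ↦ .of_map_eq_one hl h1 _⟩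
  · have hl' := hinv.mpr hl
    obtain ⟨n, hn, ha⟩ := (h.div hl0).exists_one_le h2 (inv_ne_zero hl0) hl'
    refine ⟨n, hn, fun j hj ↦ ⟨fun h' ↦ absurd hl h'.not_gt, fun h' ↦ ?_,
      fun _ ↦ (h.div hl0).one_le_mul h2 hl' hn ha hj⟩⟩
    rw [Valuation.map_sub_eq_of_lt_right w (w.map_one.trans_lt hl)] at h'
    exact absurd hl h'.not_gt

/-- Where the reduction is nonsingular, the local contribution `max 1 |u| |l|` is multiplied by
exactly `4` under duplication, up to a term that the product formula removes. -/
theorem LegendreDouble.max_mul_eq_pow_four {u u' : K} (h2 : w 2 = 1) (hl0 : l ≠ 0)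
    (h : LegendreDouble l u u') (hu : NonsingularReduction w l u) :
    max (max 1 (w u')) (max 1 (w l)) * w (4 * (u * (u - 1) * (u - l))) =
      max (max 1 (w u)) (max 1 (w l)) ^ 4 := by
  have hle : ∀ {x y : WithZero (Multiplicative ℤ)}, y ≤ 1 → max (max 1 x) (max 1 y) = max 1 x :=
    fun hy ↦ by rw [max_eq_left hy, max_eq_left (le_max_left _ _)]
  rcases lt_trichotomy (w l) 1 with hl | hl | hl
  · obtain ⟨h1, h3⟩ := h.eq_pow_four_of_map_lt_one h2 hl (hu.1 hl)
    rw [hle hl.le, hle hl.le, max_eq_right h1, max_eq_right (hu.1 hl), h3]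
  · rw [hle hl.le, hle hl.le]
    rcases (w.map_sub_le w.map_one.le hl.le : w (1 - l) ≤ 1).lt_or_eq with hl1 | hl1
    · have hu1 := hu.2.1 hl1
      obtain ⟨h1, h3⟩ := h.one_sub.eq_pow_four_of_map_lt_one h2 hl1 hu1
      have hmax : ∀ x : K, max 1 (w x) = max 1 (w (1 - x)) := fun x ↦ le_antisymm
        (max_le (le_max_left _ _) (by
          have : w (1 - (1 - x)) ≤ max 1 (w (1 - x)) := w.map_sub_le (w.map_one.trans_le
            (le_max_left _ _)) (le_max_right _ _)
          rwa [sub_sub_cancel] at this))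
        (max_le (le_max_left _ _) (w.map_sub_le (w.map_one.trans_le (le_max_left _ _))
          (le_max_right _ _)))
      rw [hmax u', hmax u, max_eq_right h1, max_eq_right hu1, ← h3, ← Valuation.map_neg w (4 * _)]
      congr 2
      ring
    · exact h.max_one_mul_eq_of_map_eq_one h2 hl hl1
  · have hl' : w l⁻¹ < 1 := by
      rw [map_inv₀]; exact inv_lt_one_of_one_lt₀ hl
    have hu1 := hu.2.2 hl'
    obtain ⟨h1, h3⟩ := (h.div hl0).eq_pow_four_of_map_lt_one h2 hl' hu1
    have hwl0 : 0 < w l := zero_lt_one.trans hl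
    have hmax : ∀ x : K, 1 ≤ w (x / l) → max (max 1 (w x)) (max 1 (w l)) = w x := fun x hx ↦ by
      rw [map_div₀, one_le_div₀ hwl0] at hx
      rw [max_eq_right hl.le, max_eq_right (hl.le.trans hx), max_eq_left hx]
    rw [hmax _ h1, hmax _ hu1]
    have e : 4 * (u / l * (u / l - 1) * (u / l - l⁻¹)) = 4 * (u * (u - 1) * (u - l)) / l ^ 3 := by
      field_simp
    -- the denominators `l ^ 3` and `l` of the rescaled formula combine to `l ^ 4`
    rw [e, map_div₀, map_div₀, map_div₀, map_pow, div_pow, div_mul_div_comm, ← pow_succ'] at h3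
    exact (div_left_inj' (pow_pos hwl0 4).ne').mp h3

end localTheory

end

/-! ### Global height inequalities -/

section

open scoped WithZero

section globalHeights

variable {k K : Type*} [Field k] [Field K] [Algebra k K]

theorem max_one_ne_zero (x : WithZero (Multiplicative ℤ)) : max 1 x ≠ 0 :=
  (zero_lt_one.trans_le (le_max_left _ _)).ne'

theorem places.map_two {w : Valuation K (WithZero (Multiplicative ℤ))} (hw : w ∈ places k K)
    (h2 : (2 : k) ≠ 0) : w 2 = 1 := by
  have := hw.2 2 h2
  rwa [map_ofNat] at this

variable [IsAlgClosed k]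

theorem curveHeight_add_le (hK : IsCurveFunctionField k K) (a b : K) :
    curveHeight k (a + b) ≤ curveHeight k a + curveHeight k b := by
  have ha := hasFiniteSupport_log_max_one hK a
  have hb := hasFiniteSupport_log_max_one hK b
  rw [curveHeight, curveHeight, curveHeight, ← finsum_add_distrib ha hb]
  refine finsum_le_finsum' (hasFiniteSupport_log_max_one hK _) (ha.fun_add hb) fun w ↦ ?_
  rw [← WithZero.log_mul (max_one_ne_zero _) (max_one_ne_zero _), WithZero.log_le_log
    (max_one_ne_zero _) (mul_ne_zero (max_one_ne_zero _) (max_one_ne_zero _))]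
  refine max_le (one_le_mul (le_max_left _ _) (le_max_left _ _)) ?_
  exact w.1.map_add_le
    ((le_max_right _ _).trans (le_mul_of_one_le_right' (le_max_left _ _)))
    ((le_max_right _ _).trans (le_mul_of_one_le_left' (le_max_left _ _)))

theorem curveHeight_mul_le (hK : IsCurveFunctionField k K) (a b : K) :
    curveHeight k (a * b) ≤ curveHeight k a + curveHeight k b := by
  have ha := hasFiniteSupport_log_max_one hK a
  have hb := hasFiniteSupport_log_max_one hK b
  rw [curveHeight, curveHeight, curveHeight, ← finsum_add_distrib ha hb]
  refine finsum_le_finsum' (hasFiniteSupport_log_max_one hK _) (ha.fun_add hb) fun w ↦ ?_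
  rw [← WithZero.log_mul (max_one_ne_zero _) (max_one_ne_zero _), WithZero.log_le_log
    (max_one_ne_zero _) (mul_ne_zero (max_one_ne_zero _) (max_one_ne_zero _)), map_mul]
  exact max_le (one_le_mul (le_max_left _ _) (le_max_left _ _))
    (mul_le_mul' (le_max_right _ _) (le_max_right _ _))

variable {l u₁ u₂ u₃ u₄ u u' : K}

theorem LegendreAdd.curveHeight_add_le (hK : IsCurveFunctionField k K)
    (h : LegendreAdd l u₁ u₂ u₃ u₄) :
    curveHeight k u₃ + curveHeight k u₄ ≤
      2 * curveHeight k l + 2 * curveHeight k u₁ + 2 * curveHeight k u₂ := by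
  have hne : u₁ - u₂ ≠ 0 := sub_ne_zero.mpr h.ne
  have h0 := hasFiniteSupport_log hK hne
  have h1 := hasFiniteSupport_log_max_one hK u₁
  have h2 := hasFiniteSupport_log_max_one hK u₂
  have h3 := hasFiniteSupport_log_max_one hK u₃
  have h4 := hasFiniteSupport_log_max_one hK u₄
  have hl := hasFiniteSupport_log_max_one hK l
  have key : ∑ᶠ w : places k K, (WithZero.log (max 1 (w.1 u₃)) + WithZero.log (max 1 (w.1 u₄)) +
        2 * WithZero.log (w.1 (u₁ - u₂))) ≤
      ∑ᶠ w : places k K, (2 * WithZero.log (max 1 (w.1 l)) + 2 * WithZero.log (max 1 (w.1 u₁)) +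
        2 * WithZero.log (max 1 (w.1 u₂))) := by
    refine finsum_le_finsum' (by fun_prop) (by fun_prop) fun w ↦ ?_
    have hw : w.1 (u₁ - u₂) ≠ 0 := (w.1.ne_zero_iff).mpr hne
    have := (WithZero.log_le_log (by simp [hw]) (by simp)).mpr (h.max_one_mul_max_one_le w.1)
    simpa [WithZero.log_mul, WithZero.log_pow, max_one_ne_zero, hw] using this
  rw [finsum_add_distrib (by fun_prop) (by fun_prop), finsum_add_distrib (by fun_prop)
    (by fun_prop), finsum_add_distrib (by fun_prop) (by fun_prop), finsum_add_distrib (by fun_prop)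
    (by fun_prop), ← mul_finsum, ← mul_finsum, ← mul_finsum, ← mul_finsum,
    finsum_log_eq_zero hK hne] at key
  simpa [curveHeight] using key

theorem LegendreDouble.curveHeight_le (hK : IsCurveFunctionField k K)
    (h : LegendreDouble l u u') :
    curveHeight k u' ≤ 2 * curveHeight k l + 4 * curveHeight k u := by
  have h0 := hasFiniteSupport_log hK h.ne
  have h1 := hasFiniteSupport_log_max_one hK u
  have h2 := hasFiniteSupport_log_max_one hK u'
  have hl := hasFiniteSupport_log_max_one hK l
  have key : ∑ᶠ w : places k K, (WithZero.log (max 1 (w.1 u')) +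
        WithZero.log (w.1 (4 * (u * (u - 1) * (u - l))))) ≤
      ∑ᶠ w : places k K, (2 * WithZero.log (max 1 (w.1 l)) +
        4 * WithZero.log (max 1 (w.1 u))) := by
    refine finsum_le_finsum' (by fun_prop) (by fun_prop) fun w ↦ ?_
    have hw : w.1 (4 * (u * (u - 1) * (u - l))) ≠ 0 := (w.1.ne_zero_iff).mpr h.ne
    have := (WithZero.log_le_log (mul_ne_zero (max_one_ne_zero _) hw)
      (mul_ne_zero (pow_ne_zero _ (max_one_ne_zero _)) (pow_ne_zero _ (max_one_ne_zero _)))).mpr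
      (h.max_one_mul_le w.1)
    rwa [WithZero.log_mul (max_one_ne_zero _) hw, WithZero.log_mul (pow_ne_zero _
      (max_one_ne_zero _)) (pow_ne_zero _ (max_one_ne_zero _)), WithZero.log_pow,
      WithZero.log_pow] at this
  rw [finsum_add_distrib (by fun_prop) (by fun_prop), finsum_add_distrib (by fun_prop)
    (by fun_prop), ← mul_finsum, ← mul_finsum, finsum_log_eq_zero hK h.ne, add_zero] at key
  exact key

theorem LegendreDouble.four_mul_curveHeight_le (hK : IsCurveFunctionField k K)
    (h2 : (2 : k) ≠ 0) (hl0 : l ≠ 0) (hl1 : l ≠ 1) (h : LegendreDouble l u u') :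
    4 * curveHeight k u ≤ 5 * curveHeight k l + curveHeight k u' := by
  have hl : l * (l - 1) ≠ 0 := mul_ne_zero hl0 (sub_ne_zero.mpr hl1)
  have h0 := hasFiniteSupport_log hK h.ne
  have h0' := hasFiniteSupport_log hK hl
  have h1 := hasFiniteSupport_log_max_one hK u
  have h3 := hasFiniteSupport_log_max_one hK u'
  have h4 := hasFiniteSupport_log_max_one hK l
  have key : ∑ᶠ w : places k K, (2 * WithZero.log (w.1 (l * (l - 1))) +
        4 * WithZero.log (max 1 (w.1 u))) ≤
      ∑ᶠ w : places k K, (5 * WithZero.log (max 1 (w.1 l)) + WithZero.log (max 1 (w.1 u')) +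
        WithZero.log (w.1 (4 * (u * (u - 1) * (u - l))))) := by
    refine finsum_le_finsum' (by fun_prop) (by fun_prop) fun w ↦ ?_
    have hw : w.1 (4 * (u * (u - 1) * (u - l))) ≠ 0 := (w.1.ne_zero_iff).mpr h.ne
    have hw' : w.1 (l * (l - 1)) ≠ 0 := (w.1.ne_zero_iff).mpr hl
    have hpos := pow_ne_zero 5 (max_one_ne_zero (w.1 l))
    have := (WithZero.log_le_log
      (mul_ne_zero (pow_ne_zero _ hw') (pow_ne_zero _ (max_one_ne_zero _)))
      (mul_ne_zero (mul_ne_zero hpos (max_one_ne_zero _)) hw)).mpr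
      (h.le_max_one_mul w.1 (places.map_two w.2 h2))
    rwa [WithZero.log_mul (mul_ne_zero hpos (max_one_ne_zero _)) hw,
      WithZero.log_mul hpos (max_one_ne_zero _), WithZero.log_mul (pow_ne_zero _ hw')
      (pow_ne_zero _ (max_one_ne_zero _)), WithZero.log_pow, WithZero.log_pow,
      WithZero.log_pow] at this
  rw [finsum_add_distrib (by fun_prop) (by fun_prop), finsum_add_distrib (by fun_prop)
    (by fun_prop), finsum_add_distrib (by fun_prop) (by fun_prop), ← mul_finsum, ← mul_finsum,
    ← mul_finsum, finsum_log_eq_zero hK h.ne, finsum_log_eq_zero hK hl, mul_zero, add_zero,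
    zero_add] at key
  exact key

/-- A single multiple works at all places, because all but finitely many places are places of good
reduction. -/
theorem LegendreSeq.exists_forall_nonsingularReduction {a : ℕ → K}
    (hK : IsCurveFunctionField k K) (h2 : (2 : k) ≠ 0) (hl0 : l ≠ 0) (hl1 : l ≠ 1)
    (h : LegendreSeq l a) :
    ∃ n, 0 < n ∧ ∀ w ∈ places k K, ∀ j, 0 < j → NonsingularReduction w l (a (n * j)) := by
  have hl1' : 1 - l ≠ 0 := sub_ne_zero.mpr hl1.symm
  have hex (w : places k K) := h.exists_nonsingularReduction (places.map_two w.2 h2) hl0 hl1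
  choose n hn hgood using hex
  have hfin : Set.Finite {w : places k K | ¬ (w.1 l = 1 ∧ w.1 (1 - l) = 1)} := by
    refine (Set.Finite.union (hasFiniteSupport_log hK hl0)
      (hasFiniteSupport_log hK hl1')).subset fun w hw ↦ ?_
    by_contra hcon
    simp only [Set.mem_union, Function.mem_support, not_or, not_not] at hcon
    have hlog : ∀ x : K, x ≠ 0 → WithZero.log (w.1 x) = 0 → w.1 x = 1 := fun x hx hx' ↦ by
      rw [← WithZero.exp_log ((w.1.ne_zero_iff).mpr hx), hx', WithZero.exp_zero]
    exact hw ⟨hlog _ hl0 hcon.1, hlog _ hl1' hcon.2⟩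
  refine ⟨∏ w ∈ hfin.toFinset, n w, Finset.prod_pos fun w _ ↦ hn w, fun w hw j hj ↦ ?_⟩
  by_cases hb : w l = 1 ∧ w (1 - l) = 1
  · exact .of_map_eq_one hb.1 hb.2 _
  · obtain ⟨c, hc⟩ := Finset.dvd_prod_of_mem n (hfin.mem_toFinset.mpr
      (show (⟨w, hw⟩ : places k K) ∈ {w : places k K | ¬ (w.1 l = 1 ∧ w.1 (1 - l) = 1)} from hb))
    have hpos : 0 < ∏ w ∈ hfin.toFinset, n w := Finset.prod_pos fun w _ ↦ hn w
    rw [hc, mul_assoc]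
    refine hgood ⟨w, hw⟩ _ (Nat.mul_pos (Nat.pos_of_ne_zero fun h0 ↦ ?_) hj)
    rw [hc, h0, mul_zero] at hpos
    exact lt_irrefl _ hpos

/-- If `h(l) > 0`, the height grows along a sequence of multiples by duplication: the modified
height `∑ log max (1, |u|, |l|)` is exactly multiplied by `4`, and it lies between `h(l)` and
`h(u) + h(l)`. -/
theorem LegendreSeq.exists_pow_mul_curveHeight_le {a : ℕ → K} (hK : IsCurveFunctionField k K)
    (h2 : (2 : k) ≠ 0) (hl0 : l ≠ 0) (hl1 : l ≠ 1) (h : LegendreSeq l a) :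
    ∃ n, 0 < n ∧ ∀ j,
      4 ^ j * curveHeight k l ≤ curveHeight k (a (n * 2 ^ j)) + curveHeight k l := by
  obtain ⟨n, hn, hgood⟩ := h.exists_forall_nonsingularReduction hK h2 hl0 hl1
  set H : K → ℤ := fun u ↦ ∑ᶠ w : places k K, WithZero.log (max (max 1 (w.1 u)) (max 1 (w.1 l)))
    with hH
  have hne : ∀ (w : places k K) (u : K), max (max 1 (w.1 u)) (max 1 (w.1 l)) ≠ 0 := fun w u ↦
    (zero_lt_iff.mpr (max_one_ne_zero (w.1 u))).trans_le (le_max_left _ _) |>.ne'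
  have hle (w : places k K) (u : K) :
      WithZero.log (max (max 1 (w.1 u)) (max 1 (w.1 l))) ≤
        WithZero.log (max 1 (w.1 u)) + WithZero.log (max 1 (w.1 l)) := by
    rw [← WithZero.log_mul (max_one_ne_zero _) (max_one_ne_zero _), WithZero.log_le_log (hne w u)
      (mul_ne_zero (max_one_ne_zero _) (max_one_ne_zero _))]
    exact max_le (le_mul_of_one_le_right' (le_max_left _ _))
      (le_mul_of_one_le_left' (le_max_left _ _))
  have hge (w : places k K) (u : K) : WithZero.log (max 1 (w.1 l)) ≤
      WithZero.log (max (max 1 (w.1 u)) (max 1 (w.1 l))) :=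
    (WithZero.log_le_log (max_one_ne_zero _) (hne w u)).mpr (le_max_right _ _)
  have hlog (x : WithZero (Multiplicative ℤ)) : 0 ≤ WithZero.log (max 1 x) := by
    rw [← WithZero.log_one (M := ℤ)]
    exact (WithZero.log_le_log one_ne_zero (max_one_ne_zero _)).mpr (le_max_left _ _)
  have hfl := hasFiniteSupport_log_max_one hK l
  have hfin (u : K) : (fun w : places k K ↦
      WithZero.log (max (max 1 (w.1 u)) (max 1 (w.1 l)))).HasFiniteSupport := by
    refine ((hasFiniteSupport_log_max_one hK u).fun_add hfl).subset
      fun w hw hw0 ↦ hw (le_antisymm ((hle w u).trans hw0.le) ?_)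
    exact (hlog _).trans (hge w u)
  have hdouble : ∀ m, 0 < m → H (a (2 * (n * m))) = 4 * H (a (n * m)) := fun m hm ↦ by
    have hD := h.double (n * m) (Nat.mul_pos hn hm)
    have key : ∑ᶠ w : places k K,
          (WithZero.log (max (max 1 (w.1 (a (2 * (n * m))))) (max 1 (w.1 l))) +
          WithZero.log (w.1 (4 * (a (n * m) * (a (n * m) - 1) * (a (n * m) - l))))) =
        ∑ᶠ w : places k K,
          4 * WithZero.log (max (max 1 (w.1 (a (n * m)))) (max 1 (w.1 l))) :=
      finsum_congr fun w ↦ by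
        rw [← WithZero.log_mul (hne _ _) ((w.1.ne_zero_iff).mpr hD.ne),
          hD.max_mul_eq_pow_four (places.map_two w.2 h2) hl0 (hgood w.1 w.2 m hm),
          WithZero.log_pow]
        rfl
    rwa [finsum_add_distrib (hfin _) (hasFiniteSupport_log hK hD.ne), finsum_log_eq_zero hK hD.ne,
      add_zero, ← mul_finsum] at key
  refine ⟨n, hn, fun j ↦ ?_⟩
  have hpow : ∀ j, H (a (n * 2 ^ j)) = 4 ^ j * H (a (n * 2 ^ 0)) := fun j ↦ by
    induction j with
    | zero => rw [pow_zero, pow_zero, one_mul]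
    | succ j ih =>
      rw [show n * 2 ^ (j + 1) = 2 * (n * 2 ^ j) by ring, hdouble _ (by positivity), ih]
      ring
  calc 4 ^ j * curveHeight k l ≤ 4 ^ j * H (a (n * 2 ^ 0)) := by
        refine mul_le_mul_of_nonneg_left ?_ (by positivity)
        exact finsum_le_finsum' hfl (hfin _) fun w ↦ hge w _
    _ = H (a (n * 2 ^ j)) := (hpow j).symm
    _ ≤ _ := by
      have ha := hasFiniteSupport_log_max_one hK (a (n * 2 ^ j))
      rw [curveHeight, curveHeight, ← finsum_add_distrib ha hfl]
      exact finsum_le_finsum' (hfin _) (ha.fun_add hfl) fun w ↦ hle w _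

end globalHeights

end

/-! ### Canonical heights and quadratic forms -/

section

section canonicalHeight

open Filter Topology

variable {G : Type*} [AddCommGroup G] {h q : G → ℝ} {C : ℝ}

/-- Tate's telescoping argument. -/
theorem exists_tendsto_inv_four_pow_mul (h0 : ∀ P, 0 ≤ h P)
    (hadd : ∀ P Q, h (P + Q) + h (P - Q) ≤ 2 * h P + 2 * h Q + C)
    (hdouble : ∀ P, 4 * h P ≤ h (P + P) + C) (P : G) :
    ∃ x, Tendsto (fun n : ℕ ↦ ((4 : ℝ) ^ n)⁻¹ * h ((2 ^ n : ℕ) • P)) atTop (𝓝 x) := by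
  refine cauchySeq_tendsto_of_complete (cauchySeq_of_le_geometric (1 / 4 : ℝ) (C / 4) (by norm_num)
    fun n ↦ ?_)
  have e : (2 ^ (n + 1) : ℕ) • P = (2 ^ n : ℕ) • P + (2 ^ n : ℕ) • P := by
    rw [pow_succ, mul_two, add_nsmul]
  have h1 := hadd ((2 ^ n : ℕ) • P) ((2 ^ n : ℕ) • P)
  have h2 := hdouble ((2 ^ n : ℕ) • P)
  have h3 := h0 ((2 ^ n : ℕ) • P - (2 ^ n : ℕ) • P)
  have e' : ((4 : ℝ) ^ (n + 1))⁻¹ * h ((2 ^ n : ℕ) • P + (2 ^ n : ℕ) • P) -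
      ((4 : ℝ) ^ n)⁻¹ * h ((2 ^ n : ℕ) • P) =
      (h ((2 ^ n : ℕ) • P + (2 ^ n : ℕ) • P) - 4 * h ((2 ^ n : ℕ) • P)) / 4 * (1 / 4) ^ n := by
    rw [pow_succ, div_pow, one_pow]
    field_simp
  rw [dist_comm, Real.dist_eq, e, e', abs_mul, abs_of_pos (by positivity : (0 : ℝ) < (1 / 4) ^ n)]
  refine mul_le_mul_of_nonneg_right ?_ (by positivity)
  rw [abs_le]
  constructor <;> linarith

theorem tendsto_inv_four_pow_mul_const (c : ℝ) :
    Tendsto (fun n : ℕ ↦ ((4 : ℝ) ^ n)⁻¹ * c) atTop (𝓝 0) := by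
  have := (tendsto_pow_atTop_nhds_zero_of_lt_one (r := (1 / 4 : ℝ)) (by norm_num)
    (by norm_num)).mul_const c
  simpa using this

/-- The reverse of the inequality `q (P + Q) + q (P - Q) ≤ 2 q P + 2 q Q` is that same inequality
for `P + Q` and `P - Q`, because `q (2 P) = 4 q P`. -/
theorem parallelogram_law_of_tendsto
    (hadd : ∀ P Q, h (P + Q) + h (P - Q) ≤ 2 * h P + 2 * h Q + C)
    (hq : ∀ P, Tendsto (fun n : ℕ ↦ ((4 : ℝ) ^ n)⁻¹ * h ((2 ^ n : ℕ) • P)) atTop (𝓝 (q P)))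
    (P Q : G) : q (P + Q) + q (P - Q) = 2 * q P + 2 * q Q := by
  have hle : ∀ P Q, q (P + Q) + q (P - Q) ≤ 2 * q P + 2 * q Q := fun P Q ↦ by
    have h1 := (hq (P + Q)).add (hq (P - Q))
    have h2 := (((hq P).const_mul 2).add ((hq Q).const_mul 2)).add
      (tendsto_inv_four_pow_mul_const C)
    rw [add_zero] at h2
    refine le_of_tendsto_of_tendsto' h1 h2 fun n ↦ ?_
    have := mul_le_mul_of_nonneg_left (hadd ((2 ^ n : ℕ) • P) ((2 ^ n : ℕ) • Q))
      (by positivity : 0 ≤ ((4 : ℝ) ^ n)⁻¹)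
    rw [← nsmul_add, ← nsmul_sub] at this
    linarith
  have hdouble : ∀ P, q (P + P) = 4 * q P := fun P ↦ by
    refine tendsto_nhds_unique (hq (P + P)) ?_
    refine ((((tendsto_add_atTop_iff_nat 1).mpr (hq P))).const_mul 4).congr fun n ↦ ?_
    rw [← two_nsmul, smul_smul, ← pow_succ, pow_succ (4 : ℝ)]
    field_simp
  refine (hle P Q).antisymm ?_
  have h1 := hle (P + Q) (P - Q)
  rw [show P + Q + (P - Q) = P + P by abel, show P + Q - (P - Q) = Q + Q by abel, hdouble,
    hdouble] at h1
  linarith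

/-- The symmetric biadditive form attached to a function that satisfies the parallelogram law. -/
noncomputable def polarAddMonoidHom (q : G → ℝ)
    (hq : ∀ P Q, q (P + Q) + q (P - Q) = 2 * q P + 2 * q Q) : G →+ G →+ ℝ :=
  have key : ∀ P Q R, q (P + Q + R) - q (P + Q) - q R =
      (q (P + R) - q P - q R) + (q (Q + R) - q Q - q R) := fun P Q R ↦ by
    have h1 := hq (P + R) Q
    have h2 := hq (P + Q) R
    have h3 := hq P (R - Q)
    have h4 := hq R Q
    rw [show P + R + Q = P + Q + R by abel] at h1
    rw [show P + (R - Q) = P + R - Q by abel, show P - (R - Q) = P + Q - R by abel] at h3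
    rw [add_comm R Q] at h4
    linarith
  AddMonoidHom.mk' (fun P ↦ AddMonoidHom.mk' (fun Q ↦ q (P + Q) - q P - q Q) fun Q R ↦ by
      have := key Q R P
      rw [add_comm _ P, add_comm Q P, add_comm R P] at this
      linarith)
    fun P Q ↦ by
      ext R
      exact key P Q R

theorem polarAddMonoidHom_apply (hq : ∀ P Q, q (P + Q) + q (P - Q) = 2 * q P + 2 * q Q)
    (P Q : G) : polarAddMonoidHom q hq P Q = q (P + Q) - q P - q Q :=
  rfl

theorem polarAddMonoidHom_self (hq : ∀ P Q, q (P + Q) + q (P - Q) = 2 * q P + 2 * q Q)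
    (P : G) : polarAddMonoidHom q hq P P = 2 * q P := by
  have h1 := hq 0 0
  have h2 := hq P P
  rw [sub_self] at h2
  rw [add_zero, sub_zero] at h1
  rw [polarAddMonoidHom_apply]
  linarith

theorem map_nsmul_of_parallelogram_law
    (hq : ∀ P Q, q (P + Q) + q (P - Q) = 2 * q P + 2 * q Q) (n : ℕ) (P : G) :
    q (n • P) = n ^ 2 * q P := by
  have h := polarAddMonoidHom_self hq (n • P)
  rw [map_nsmul (polarAddMonoidHom q hq (n • P)), map_nsmul (polarAddMonoidHom q hq),
    AddMonoidHom.nsmul_apply, polarAddMonoidHom_self, nsmul_eq_mul, nsmul_eq_mul] at h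
  linarith

theorem sum_offDiag_map_sub (hq : ∀ P Q, q (P + Q) + q (P - Q) = 2 * q P + 2 * q Q) {N : ℕ}
    (P : Fin (N + 1) → G) :
    ∑ p ∈ (Finset.univ : Finset (Fin (N + 1))).offDiag, q (P p.1 - P p.2) =
      2 * (N + 1) * ∑ i, q (P i) - 2 * q (∑ i, P i) := by
  have h0 : q 0 = 0 := by
    have := map_nsmul_of_parallelogram_law hq 0 0
    simpa using this
  have hB : ∑ i, ∑ j, polarAddMonoidHom q hq (P i) (P j) = 2 * q (∑ i, P i) := by
    rw [← polarAddMonoidHom_self hq, map_sum (polarAddMonoidHom q hq),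
      AddMonoidHom.finsetSum_apply]
    exact Finset.sum_congr rfl fun i _ ↦ (map_sum _ _ _).symm
  have hsub : ∀ i j, q (P i - P j) = q (P i) + q (P j) - polarAddMonoidHom q hq (P i) (P j) :=
    fun i j ↦ by
      rw [polarAddMonoidHom_apply]
      linarith [hq (P i) (P j)]
  rw [Finset.sum_subset (Finset.subset_univ _) (fun p _ hp ↦ by
    have : p.1 = p.2 := by simpa using hp
    rw [this, sub_self, h0]), Fintype.sum_prod_type, ← hB]
  simp only [hsub, Finset.sum_sub_distrib, Finset.sum_add_distrib, Finset.sum_const,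
    Finset.card_univ, Fintype.card_fin, nsmul_eq_mul, ← Finset.mul_sum]
  push_cast
  ring

/-- Both parts compare the maximum of the `q (P i)` with their mean, from which a nonnegative
multiple of `q (∑ P i)` is subtracted. -/
theorem max_ge_sum_offDiag_and_eq_iff
    (hq : ∀ P Q, q (P + Q) + q (P - Q) = 2 * q P + 2 * q Q) (h0 : ∀ P, 0 ≤ q P)
    (htors : ∀ P, q P = 0 → IsOfFinAddOrder P) (N : ℕ) (P : Fin (N + 1) → G) :
    (1 / (2 * ((N : ℝ) + 1) ^ 2)) *
        ∑ p ∈ (Finset.univ : Finset (Fin (N + 1))).offDiag, q (P p.1 - P p.2) ≤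
      Finset.univ.sup' Finset.univ_nonempty (fun i ↦ q (P i)) ∧
    (Finset.univ.sup' Finset.univ_nonempty (fun i ↦ q (P i)) =
        (1 / (2 * ((N : ℝ) + 1) ^ 2)) *
          ∑ p ∈ (Finset.univ : Finset (Fin (N + 1))).offDiag, q (P p.1 - P p.2) ↔
      (∀ i j, q (P i) = q (P j)) ∧ IsOfFinAddOrder (∑ i, P i)) := by
  have htors' : ∀ P, IsOfFinAddOrder P ↔ q P = 0 := fun P ↦ by
    refine ⟨fun h ↦ ?_, htors P⟩
    obtain ⟨n, hn, hP⟩ := isOfFinAddOrder_iff_nsmul_eq_zero.mp h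
    have h1 := map_nsmul_of_parallelogram_law hq n P
    have h2 := map_nsmul_of_parallelogram_law hq 0 P
    rw [hP, ← zero_nsmul P, h2, Nat.cast_zero, zero_pow two_ne_zero, zero_mul, eq_comm,
      mul_eq_zero] at h1
    exact h1.resolve_left (pow_ne_zero _ (Nat.cast_ne_zero.mpr hn.ne'))
  rw [sum_offDiag_map_sub hq, htors']
  set M := Finset.univ.sup' Finset.univ_nonempty (fun i ↦ q (P i)) with hM
  have hN : (0 : ℝ) < N + 1 := by positivity
  have hle : ∀ i, q (P i) ≤ M := fun i ↦ Finset.le_sup' (fun i ↦ q (P i)) (Finset.mem_univ i)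
  have hconst : ∑ _i : Fin (N + 1), M = (N + 1) * M := by simp
  have hsum : ∑ i, q (P i) ≤ (N + 1) * M := by
    rw [← hconst]
    exact Finset.sum_le_sum fun i _ ↦ hle i
  have hz := h0 (∑ i, P i)
  have e : 1 / (2 * ((N : ℝ) + 1) ^ 2) * (2 * (N + 1) * ∑ i, q (P i) - 2 * q (∑ i, P i)) =
      ((N + 1) * ∑ i, q (P i) - q (∑ i, P i)) / (N + 1) ^ 2 := by
    field_simp
  have hmul := mul_le_mul_of_nonneg_left hsum hN.le
  rw [e, div_le_iff₀ (by positivity), eq_div_iff (by positivity)]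
  refine ⟨by linarith, fun h ↦ ?_, fun ⟨h1, h2⟩ ↦ ?_⟩
  · have hq0 : q (∑ i, P i) = 0 := by linarith
    have hS : ∑ i, q (P i) = ∑ _i : Fin (N + 1), M := by
      rw [hconst]
      have : ((N : ℝ) + 1) * ((N + 1) * M - ∑ i, q (P i)) = 0 := by linarith
      linarith [(mul_eq_zero.mp this).resolve_left hN.ne']
    have hall := (Finset.sum_eq_sum_iff_of_le fun i _ ↦ hle i).mp hS
    exact ⟨fun i j ↦ (hall i (Finset.mem_univ i)).trans (hall j (Finset.mem_univ j)).symm, hq0⟩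
  · have hMe : M = q (P 0) := le_antisymm (Finset.sup'_le _ _ fun i _ ↦ (h1 i 0).le) (hle 0)
    have hS : ∑ i, q (P i) = (N + 1) * q (P 0) := by
      rw [Finset.sum_congr rfl fun i _ ↦ h1 i 0]
      simp
    rw [hS, h2, hMe]
    ring

end canonicalHeight

end

/-! ### The Legendre coordinate of a point of an elliptic curve -/

section

open WeierstrassCurve Affine

section algebra

variable {K : Type*} [Field K] {l c u₁ u₂ u₃ u₄ Y₁ Y₂ : K}

/-- The chord construction on the twist `Y² = c u (u - 1) (u - l)` of the Legendre curve. -/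
theorem LegendreAdd.of_chord (hc : c ≠ 0) (hne : u₁ ≠ u₂)
    (h₁ : Y₁ ^ 2 = c * (u₁ * (u₁ - 1) * (u₁ - l))) (h₂ : Y₂ ^ 2 = c * (u₂ * (u₂ - 1) * (u₂ - l)))
    (h₃ : c * (u₃ + u₁ + u₂ - 1 - l) * (u₁ - u₂) ^ 2 = (Y₁ - Y₂) ^ 2)
    (h₄ : c * (u₄ + u₁ + u₂ - 1 - l) * (u₁ - u₂) ^ 2 = (Y₁ + Y₂) ^ 2) :
    LegendreAdd l u₁ u₂ u₃ u₄ := by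
  have hd : (u₁ - u₂) ^ 2 ≠ 0 := pow_ne_zero 2 (sub_ne_zero.mpr hne)
  have hadd : (u₃ + u₄) * (u₁ - u₂) ^ 2 =
      2 * (u₁ + u₂) * (u₁ * u₂ + l) - 4 * (1 + l) * (u₁ * u₂) := by
    refine mul_left_cancel₀ hc ?_
    linear_combination h₃ + h₄ + 2 * h₁ + 2 * h₂
  refine ⟨hne, hadd, mul_left_cancel₀ (mul_ne_zero (pow_ne_zero 2 hc) hd) ?_⟩
  have hmul : c ^ 2 * ((u₃ + u₁ + u₂ - 1 - l) * (u₁ - u₂) ^ 2) *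
      ((u₄ + u₁ + u₂ - 1 - l) * (u₁ - u₂) ^ 2) =
      c ^ 2 * (u₁ * (u₁ - 1) * (u₁ - l) - u₂ * (u₂ - 1) * (u₂ - l)) ^ 2 := by
    linear_combination (c * (u₄ + u₁ + u₂ - 1 - l) * (u₁ - u₂) ^ 2) * h₃ + (Y₁ - Y₂) ^ 2 * h₄ +
      (Y₁ ^ 2 - Y₂ ^ 2 + c * (u₁ * (u₁ - 1) * (u₁ - l) - u₂ * (u₂ - 1) * (u₂ - l))) * (h₁ - h₂)
  linear_combination hmul - c ^ 2 * (u₁ + u₂ - 1 - l) * (u₁ - u₂) ^ 2 * hadd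

/-- The tangent construction on the twist `Y² = c u (u - 1) (u - l)` of the Legendre curve. -/
theorem LegendreDouble.of_tangent (h2 : (2 : K) ≠ 0) (hc : c ≠ 0) (hY : Y₁ ≠ 0)
    (h₁ : Y₁ ^ 2 = c * (u₁ * (u₁ - 1) * (u₁ - l)))
    (h₃ : 4 * c * (u₃ + 2 * u₁ - 1 - l) * Y₁ ^ 2 =
      c ^ 2 * (3 * u₁ ^ 2 - 2 * (1 + l) * u₁ + l) ^ 2) :
    LegendreDouble l u₁ u₃ := by
  refine ⟨mul_ne_zero (by rw [show (4 : K) = 2 ^ 2 by norm_num]; exact pow_ne_zero 2 h2)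
    fun h ↦ hY (pow_eq_zero_iff two_ne_zero |>.mp (by rw [h₁, h, mul_zero])), ?_⟩
  refine mul_left_cancel₀ (pow_ne_zero 2 hc) ?_
  linear_combination h₃ - 4 * c * (u₃ + 2 * u₁ - 1 - l) * h₁

end algebra

namespace WeierstrassCurve

variable {K : Type*} [Field K] (W : WeierstrassCurve K)

/-- `e₁`, `e₂`, `e₃` are the three distinct roots of the `2`-torsion polynomial
`4 X³ + b₂ X² + 2 b₄ X + b₆`. -/
structure IsTwoTorsionTriple (e₁ e₂ e₃ : K) : Prop where
  b₂ : W.b₂ = -4 * (e₁ + e₂ + e₃)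
  b₄ : W.b₄ = 2 * (e₁ * e₂ + e₁ * e₃ + e₂ * e₃)
  b₆ : W.b₆ = -4 * (e₁ * e₂ * e₃)
  ne₁₂ : e₂ - e₁ ≠ 0
  ne₁₃ : e₃ - e₁ ≠ 0
  ne₂₃ : e₃ - e₂ ≠ 0

theorem exists_isTwoTorsionTriple [IsAlgClosed K] [W.IsElliptic] (h2 : (2 : K) ≠ 0) :
    ∃ e₁ e₂ e₃, W.IsTwoTorsionTriple e₁ e₂ e₃ := by
  have h4 : (4 : K) ≠ 0 := by rw [show (4 : K) = 2 ^ 2 by norm_num]; exact pow_ne_zero 2 h2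
  have ha : W.twoTorsionPolynomial.a ≠ 0 := h4
  obtain ⟨x, y, z, h3⟩ := (Cubic.splits_iff_roots_eq_three (φ := RingHom.id K) ha).mp
    (IsAlgClosed.splits _)
  have hne := (Cubic.discr_ne_zero_iff_roots_ne ha h3).mp
    (W.twoTorsionPolynomial_discr_ne_zero h2.isUnit W.isUnit_Δ)
  refine ⟨x, y, z, ?_, mul_left_cancel₀ h2 ?_, ?_, sub_ne_zero.mpr hne.1.symm,
    sub_ne_zero.mpr hne.2.1.symm, sub_ne_zero.mpr hne.2.2.symm⟩
  · have : W.b₂ = 4 * -(x + y + z) := Cubic.b_eq_three_roots ha h3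
    rw [this]; ring
  · have : 2 * W.b₄ = 4 * (x * y + x * z + y * z) := Cubic.c_eq_three_roots ha h3
    rw [this]; ring
  · have : W.b₆ = 4 * -(x * y * z) := Cubic.d_eq_three_roots ha h3
    rw [this]; ring

variable {W} {e₁ e₂ e₃ : K}

/-- The `j`-invariant of `y² = u (u - 1) (u - l)`. -/
theorem IsTwoTorsionTriple.j_eq [W.IsElliptic] (h2 : (2 : K) ≠ 0)
    (hW : W.IsTwoTorsionTriple e₁ e₂ e₃) {l : K} (hl : e₃ - e₁ = (e₂ - e₁) * l) :
    W.j = 256 * (l ^ 2 - l + 1) ^ 3 / (l ^ 2 * (l - 1) ^ 2) := by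
  have h4 : (4 : K) ≠ 0 := by rw [show (4 : K) = 2 ^ 2 by norm_num]; exact pow_ne_zero 2 h2
  have hl0 : l ≠ 0 := by
    rintro rfl
    exact hW.ne₁₃ (by rw [hl, mul_zero])
  have hl1 : l - 1 ≠ 0 := fun h ↦ hW.ne₂₃ (by linear_combination hl + (e₂ - e₁) * h)
  obtain rfl : e₃ = e₁ + (e₂ - e₁) * l := by linear_combination hl
  have hc₄ : W.c₄ = 16 * (e₂ - e₁) ^ 2 * (l ^ 2 - l + 1) := by
    rw [c₄, hW.b₂, hW.b₄]
    ring
  have hΔ : W.Δ = 16 * (e₂ - e₁) ^ 6 * (l ^ 2 * (l - 1) ^ 2) := by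
    refine mul_left_cancel₀ h4 ?_
    rw [Δ]
    have := W.b_relation
    rw [hW.b₂, hW.b₄, hW.b₆] at *
    linear_combination -(-4 * (e₁ + e₂ + (e₁ + (e₂ - e₁) * l))) ^ 2 * this
  have hΔ0 : W.Δ ≠ 0 := W.isUnit_Δ.ne_zero
  rw [eq_div_iff (mul_ne_zero (pow_ne_zero 2 hl0) (pow_ne_zero 2 hl1)), j, hc₄,
    Units.val_inv_eq_inv_val, coe_Δ', mul_assoc, inv_mul_eq_iff_eq_mul₀ hΔ0, hΔ]
  ring

/-- The coordinate `(x - e₁) / (e₂ - e₁)`, in which `2`-torsion points have coordinates `0`, `1` and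
`l`. The point at infinity gets the value `0`, an element of height `0`. -/
def legendreCoord (W : WeierstrassCurve K) (e₁ e₂ : K) : W.toAffine.Point → K
  | .zero => 0
  | .some x _ _ => (x - e₁) / (e₂ - e₁)

theorem legendreCoord_neg (e₁ e₂ : K) (P : W.toAffine.Point) :
    W.legendreCoord e₁ e₂ (-P) = W.legendreCoord e₁ e₂ P := by
  rcases P with _ | ⟨x, y, h⟩ <;> rfl

/-- The Weierstrass equation in terms of `2 y + a₁ x + a₃` and the Legendre coordinate. -/
theorem IsTwoTorsionTriple.sq_eq (hW : W.IsTwoTorsionTriple e₁ e₂ e₃) {l : K}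
    (hl : e₃ - e₁ = (e₂ - e₁) * l) {x y : K} (h : W.toAffine.Nonsingular x y) :
    (y - W.toAffine.negY x y) ^ 2 = 4 * (e₂ - e₁) ^ 3 * ((x - e₁) / (e₂ - e₁) *
      ((x - e₁) / (e₂ - e₁) - 1) * ((x - e₁) / (e₂ - e₁) - l)) := by
  have hne := hW.ne₁₂
  have h1 := (W.toAffine.equation_iff x y).mp h.1
  have h2 : (y - W.toAffine.negY x y) ^ 2 = 4 * ((x - e₁) * (x - e₂) * (x - e₃)) := by
    have e2 := hW.b₂
    have e4 := hW.b₄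
    have e6 := hW.b₆
    simp only [WeierstrassCurve.b₂, WeierstrassCurve.b₄, WeierstrassCurve.b₆] at e2 e4 e6
    rw [negY]
    linear_combination 4 * h1 + x ^ 2 * e2 + 2 * x * e4 + e6
  obtain rfl : e₃ = e₁ + (e₂ - e₁) * l := by linear_combination hl
  rw [h2]
  field_simp
  ring

variable [DecidableEq K]

theorem IsTwoTorsionTriple.legendreAdd (h2 : (2 : K) ≠ 0) (hW : W.IsTwoTorsionTriple e₁ e₂ e₃)
    {l : K} (hl : e₃ - e₁ = (e₂ - e₁) * l) {P Q : W.toAffine.Point} (hP : P ≠ 0) (hQ : Q ≠ 0)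
    (hne : P ≠ Q) (hne' : P ≠ -Q) :
    LegendreAdd l (W.legendreCoord e₁ e₂ P) (W.legendreCoord e₁ e₂ Q)
      (W.legendreCoord e₁ e₂ (P + Q)) (W.legendreCoord e₁ e₂ (P - Q)) := by
  have h4 : (4 : K) ≠ 0 := by rw [show (4 : K) = 2 ^ 2 by norm_num]; exact pow_ne_zero 2 h2
  have hD := hW.ne₁₂
  rcases P with _ | ⟨x₁, y₁, h₁⟩
  · exact absurd rfl hP
  rcases Q with _ | ⟨x₂, y₂, h₂⟩
  · exact absurd rfl hQ
  have hx : x₁ ≠ x₂ := fun h ↦ (Point.X_eq_iff.mp h).elim hne hne'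
  have hx' : x₁ - x₂ ≠ 0 := sub_ne_zero.mpr hx
  have e2 := hW.b₂
  rw [WeierstrassCurve.b₂] at e2
  rw [sub_eq_add_neg, Point.neg_some, Point.add_of_X_ne hx, Point.add_of_X_ne hx]
  simp only [legendreCoord]
  have hs : ∀ y, 4 * (e₂ - e₁) ^ 3 * ((W.toAffine.addX x₁ x₂ (W.toAffine.slope x₁ x₂ y₁ y) - e₁) /
      (e₂ - e₁) + (x₁ - e₁) / (e₂ - e₁) + (x₂ - e₁) / (e₂ - e₁) - 1 - l) *
      ((x₁ - e₁) / (e₂ - e₁) - (x₂ - e₁) / (e₂ - e₁)) ^ 2 =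
      ((y₁ - W.toAffine.negY x₁ y₁) - (y - W.toAffine.negY x₂ y)) ^ 2 := fun y ↦ by
    rw [slope_of_X_ne hx, addX, negY, negY]
    field_simp
    linear_combination -(x₁ - x₂) ^ 4 * e2 + 4 * (x₁ - x₂) ^ 4 * hl
  refine .of_chord (c := 4 * (e₂ - e₁) ^ 3) (mul_ne_zero h4 (pow_ne_zero 3 hD)) (fun h ↦ hx ?_)
    (hW.sq_eq hl h₁) (hW.sq_eq hl h₂) (hs y₂) ?_
  · linear_combination (div_left_inj' hD).mp h
  · rw [hs, negY_negY]
    ring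

theorem IsTwoTorsionTriple.legendreDouble (h2 : (2 : K) ≠ 0)
    (hW : W.IsTwoTorsionTriple e₁ e₂ e₃) {l : K} (hl : e₃ - e₁ = (e₂ - e₁) * l)
    {P : W.toAffine.Point} (hP : P + P ≠ 0) :
    LegendreDouble l (W.legendreCoord e₁ e₂ P) (W.legendreCoord e₁ e₂ (P + P)) := by
  have h4 : (4 : K) ≠ 0 := by rw [show (4 : K) = 2 ^ 2 by norm_num]; exact pow_ne_zero 2 h2
  have hD := hW.ne₁₂
  rcases P with _ | ⟨x, y, h⟩
  · exact absurd (add_zero _) hP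
  have hy : y ≠ W.toAffine.negY x y := fun hy ↦ hP (Point.add_self_of_Y_eq hy)
  have hy' : y - W.toAffine.negY x y ≠ 0 := sub_ne_zero.mpr hy
  rw [Point.add_self_of_Y_ne hy]
  simp only [legendreCoord]
  refine .of_tangent h2 (c := 4 * (e₂ - e₁) ^ 3) (mul_ne_zero h4 (pow_ne_zero 3 hD)) hy'
    (hW.sq_eq hl h) ?_
  have e2 := hW.b₂
  have e4 := hW.b₄
  rw [slope_of_Y_ne rfl hy, addX]
  set Y := y - W.toAffine.negY x y with hY
  have hYe : Y = 2 * y + W.a₁ * x + W.a₃ := by rw [hY, negY]; ring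
  have hx : 4 * (((3 * x ^ 2 + 2 * W.a₂ * x + W.a₄ - W.a₁ * y) / Y) ^ 2 + W.a₁ *
      ((3 * x ^ 2 + 2 * W.a₂ * x + W.a₄ - W.a₁ * y) / Y) - W.a₂ - x - x + 2 * x) * Y ^ 2 =
      (6 * x ^ 2 + W.b₂ * x + W.b₄) ^ 2 - W.b₂ * Y ^ 2 := by
    rw [WeierstrassCurve.b₂, WeierstrassCurve.b₄]
    field_simp
    rw [hYe]
    ring
  generalize ((3 * x ^ 2 + 2 * W.a₂ * x + W.a₄ - W.a₁ * y) / Y) ^ 2 + W.a₁ *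
      ((3 * x ^ 2 + 2 * W.a₂ * x + W.a₄ - W.a₁ * y) / Y) - W.a₂ - x - x = x₃ at hx ⊢
  rw [e2, e4] at hx
  obtain rfl : e₃ = e₁ + (e₂ - e₁) * l := by linear_combination hl
  field_simp
  refine mul_left_cancel₀ h4 ?_
  linear_combination hx

end WeierstrassCurve

end

/-! ### Weil heights of Legendre coordinates -/

section

open IntermediateField WeierstrassCurve

section of_map

variable {K K' : Type*} [Field K] [Field K'] (f : K →+* K') {l u₁ u₂ u₃ u₄ u u' : K}

theorem LegendreAdd.of_map (h : LegendreAdd (f l) (f u₁) (f u₂) (f u₃) (f u₄)) :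
    LegendreAdd l u₁ u₂ u₃ u₄ :=
  ⟨fun h' ↦ h.ne (congrArg f h'), f.injective (by simpa [map_ofNat f] using h.add),
    f.injective (by simpa using h.mul)⟩

theorem LegendreDouble.of_map (h : LegendreDouble (f l) (f u) (f u')) : LegendreDouble l u u' :=
  ⟨fun h' ↦ h.ne (by
      simpa only [map_mul, map_sub, map_one, map_zero, map_ofNat f] using congrArg f h'),
    f.injective (by simpa [map_ofNat f] using h.eq)⟩

end of_map

section weilHeight

variable {k F Fbar : Type*} [Field k] [Field F] [Field Fbar] [Algebra k F] [Algebra F Fbar]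
  [Algebra k Fbar] [IsScalarTower k F Fbar]

theorem finrank_cast_pos (L : IntermediateField F Fbar) [FiniteDimensional F L] :
    (0 : ℝ) < Module.finrank F L :=
  Nat.cast_pos.mpr Module.finrank_pos

theorem weilHeight_algebraMap [IsAlgClosed k] (hF : IsCurveFunctionField k F) (c : k) :
    weilHeight k F (algebraMap k Fbar c) = 0 := by
  have := weilHeight_eq_curveHeight_div hF (⊥ : IntermediateField F Fbar)
    (algebraMap k (⊥ : IntermediateField F Fbar) c)
  rwa [curveHeight_algebraMap, Int.cast_zero, zero_div] at this

variable [Algebra.IsAlgebraic F Fbar]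

theorem exists_finiteDimensional_le (F : Type*) {Fbar : Type*} [Field F] [Field Fbar]
    [Algebra F Fbar] [Algebra.IsAlgebraic F Fbar] (s : Set Fbar) (hs : s.Finite) :
    ∃ L : IntermediateField F Fbar, FiniteDimensional F L ∧ s ⊆ L :=
  have := hs.to_subtype
  ⟨adjoin F s, finiteDimensional_adjoin fun x _ ↦ Algebra.IsIntegral.isIntegral x,
    subset_adjoin F s⟩

variable [IsAlgClosed k]

theorem weilHeight_nonneg (hF : IsCurveFunctionField k F) (a : Fbar) : 0 ≤ weilHeight k F a := by
  obtain ⟨L, _, hL⟩ := exists_finiteDimensional_le F {a} (Set.toFinite _)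
  lift a to L using hL (by simp)
  rw [weilHeight_eq_curveHeight_div hF]
  exact div_nonneg (by exact_mod_cast curveHeight_nonneg a) (finrank_cast_pos L).le

theorem weilHeight_pos (hF : IsCurveFunctionField k F) {a : Fbar}
    (ha : a ∉ Set.range (algebraMap k Fbar)) :
    0 < weilHeight k F a := by
  obtain ⟨L, _, hL⟩ := exists_finiteDimensional_le F {a} (Set.toFinite _)
  lift a to L using hL (by simp)
  rw [weilHeight_eq_curveHeight_div hF]
  refine div_pos (Int.cast_pos.mpr (curveHeight_pos hF.of_finiteDimensional ?_))
    (finrank_cast_pos L)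
  rintro ⟨c, rfl⟩
  exact ha ⟨c, rfl⟩

theorem weilHeight_add_le (hF : IsCurveFunctionField k F) (a b : Fbar) :
    weilHeight k F (a + b) ≤ weilHeight k F a + weilHeight k F b := by
  obtain ⟨L, _, hL⟩ := exists_finiteDimensional_le F {a, b} (Set.toFinite _)
  lift a to L using hL (by simp)
  lift b to L using hL (by simp)
  have := finrank_cast_pos L
  rw [← IntermediateField.coe_add, weilHeight_eq_curveHeight_div hF,
    weilHeight_eq_curveHeight_div hF,
    weilHeight_eq_curveHeight_div hF, ← add_div, div_le_div_iff_of_pos_right this]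
  exact_mod_cast curveHeight_add_le hF.of_finiteDimensional a b

theorem weilHeight_mul_le (hF : IsCurveFunctionField k F) (a b : Fbar) :
    weilHeight k F (a * b) ≤ weilHeight k F a + weilHeight k F b := by
  obtain ⟨L, _, hL⟩ := exists_finiteDimensional_le F {a, b} (Set.toFinite _)
  lift a to L using hL (by simp)
  lift b to L using hL (by simp)
  have := finrank_cast_pos L
  rw [← IntermediateField.coe_mul, weilHeight_eq_curveHeight_div hF,
    weilHeight_eq_curveHeight_div hF,
    weilHeight_eq_curveHeight_div hF, ← add_div, div_le_div_iff_of_pos_right this]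
  exact_mod_cast curveHeight_mul_le hF.of_finiteDimensional a b

variable {l u₁ u₂ u₃ u₄ u u' : Fbar}

theorem LegendreAdd.weilHeight_add_le (hF : IsCurveFunctionField k F)
    (h : LegendreAdd l u₁ u₂ u₃ u₄) :
    weilHeight k F u₃ + weilHeight k F u₄ ≤
      2 * weilHeight k F l + 2 * weilHeight k F u₁ + 2 * weilHeight k F u₂ := by
  obtain ⟨L, _, hL⟩ := exists_finiteDimensional_le F {l, u₁, u₂, u₃, u₄} (Set.toFinite _)
  lift l to L using hL (by simp)
  lift u₁ to L using hL (by simp)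
  lift u₂ to L using hL (by simp)
  lift u₃ to L using hL (by simp)
  lift u₄ to L using hL (by simp)
  have := finrank_cast_pos L
  simp only [weilHeight_eq_curveHeight_div hF]
  rw [← mul_div_assoc, ← mul_div_assoc, ← mul_div_assoc, ← add_div, ← add_div, ← add_div,
    div_le_div_iff_of_pos_right this]
  exact_mod_cast (LegendreAdd.of_map (algebraMap L Fbar) h).curveHeight_add_le
    (k := k) hF.of_finiteDimensional

theorem LegendreDouble.weilHeight_le (hF : IsCurveFunctionField k F) (h : LegendreDouble l u u') :
    weilHeight k F u' ≤ 2 * weilHeight k F l + 4 * weilHeight k F u := by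
  obtain ⟨L, _, hL⟩ := exists_finiteDimensional_le F {l, u, u'} (Set.toFinite _)
  lift l to L using hL (by simp)
  lift u to L using hL (by simp)
  lift u' to L using hL (by simp)
  have := finrank_cast_pos L
  simp only [weilHeight_eq_curveHeight_div hF]
  rw [← mul_div_assoc, ← mul_div_assoc, ← add_div, div_le_div_iff_of_pos_right this]
  exact_mod_cast (LegendreDouble.of_map (algebraMap L Fbar) h).curveHeight_le
    (k := k) hF.of_finiteDimensional

theorem LegendreDouble.four_mul_weilHeight_le (hF : IsCurveFunctionField k F) (h2 : (2 : k) ≠ 0)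
    (hl0 : l ≠ 0) (hl1 : l ≠ 1) (h : LegendreDouble l u u') :
    4 * weilHeight k F u ≤ 5 * weilHeight k F l + weilHeight k F u' := by
  obtain ⟨L, _, hL⟩ := exists_finiteDimensional_le F {l, u, u'} (Set.toFinite _)
  lift l to L using hL (by simp)
  lift u to L using hL (by simp)
  lift u' to L using hL (by simp)
  have := finrank_cast_pos L
  simp only [weilHeight_eq_curveHeight_div hF]
  rw [← mul_div_assoc, ← mul_div_assoc, ← add_div, div_le_div_iff_of_pos_right this]
  exact_mod_cast (LegendreDouble.of_map (algebraMap L Fbar) h).four_mul_curveHeight_le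
    (k := k) hF.of_finiteDimensional h2 (by simpa using hl0) (by simpa using hl1)

/-- The whole sequence lies in the field generated by `l` and its first term, by the formulas for
`u(2 P)` and `u((n + 1) P)`. -/
theorem LegendreSeq.exists_pow_mul_weilHeight_le (hF : IsCurveFunctionField k F) (h2 : (2 : k) ≠ 0)
    (hl0 : l ≠ 0) (hl1 : l ≠ 1) {a : ℕ → Fbar} (ha : a 0 = 0) (h : LegendreSeq l a) :
    ∃ n, 0 < n ∧ ∀ j, 4 ^ j * weilHeight k F l ≤
      weilHeight k F (a (n * 2 ^ j)) + weilHeight k F l := by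
  obtain ⟨L, _, hL⟩ := exists_finiteDimensional_le F {l, a 1} (Set.toFinite _)
  have hlL : l ∈ L := hL (by simp)
  have h1L : a 1 ∈ L := hL (by simp)
  have hmem : ∀ n, a n ∈ L ∧ a (n + 1) ∈ L := fun n ↦ by
    induction n with
    | zero => exact ⟨ha ▸ L.zero_mem, h1L⟩
    | succ n ih =>
      refine ⟨ih.2, ?_⟩
      rcases n.eq_zero_or_pos with rfl | hn
      · have hD := h.double 1 one_pos
        have : a (0 + 1 + 1) =
            (a 1 ^ 2 - l) ^ 2 / ((4 : ℕ) * (a 1 * (a 1 - 1) * (a 1 - l))) := by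
          rw [Nat.cast_ofNat, eq_div_iff hD.ne]
          exact hD.eq
        rw [this]
        exact L.div_mem (pow_mem (L.sub_mem (pow_mem h1L _) hlL) _)
          (L.mul_mem (L.natCast_mem 4)
          (L.mul_mem (L.mul_mem h1L (L.sub_mem h1L L.one_mem)) (L.sub_mem h1L hlL)))
      · have hA := h.add (n + 1) 1 one_pos (by omega)
        rw [Nat.add_sub_cancel] at hA
        have hd : (a (n + 1) - a 1) ^ 2 ≠ 0 := pow_ne_zero 2 (sub_ne_zero.mpr hA.ne)
        have : a (n + 1 + 1) = ((2 : ℕ) * (a (n + 1) + a 1) * (a (n + 1) * a 1 + l) -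
            (4 : ℕ) * (1 + l) * (a (n + 1) * a 1)) / (a (n + 1) - a 1) ^ 2 - a n := by
          rw [Nat.cast_ofNat, Nat.cast_ofNat, eq_sub_iff_add_eq, eq_div_iff hd]
          exact hA.add
        rw [this]
        have hm := L.mul_mem ih.2 h1L
        exact L.sub_mem (L.div_mem (L.sub_mem (L.mul_mem (L.mul_mem (L.natCast_mem 2)
          (L.add_mem ih.2 h1L)) (L.add_mem hm hlL)) (L.mul_mem (L.mul_mem (L.natCast_mem 4)
          (L.add_mem L.one_mem hlL)) hm)) (pow_mem (L.sub_mem ih.2 h1L) _)) ih.1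
  lift a to ℕ → L using fun n ↦ (hmem n).1
  lift l to L using hlL
  have hseq : LegendreSeq l a :=
    ⟨fun n hn ↦ LegendreDouble.of_map (algebraMap L Fbar) (h.double n hn),
      fun m n hn hmn ↦ LegendreAdd.of_map (algebraMap L Fbar) (h.add m n hn hmn)⟩
  obtain ⟨n, hn, hle⟩ := hseq.exists_pow_mul_curveHeight_le (k := k) hF.of_finiteDimensional h2
    (by simpa using hl0) (by simpa using hl1)
  refine ⟨n, hn, fun j ↦ ?_⟩
  have := finrank_cast_pos L
  simp only [weilHeight_eq_curveHeight_div hF]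
  rw [← mul_div_assoc, ← add_div, div_le_div_iff_of_pos_right this]
  exact_mod_cast hle j

end weilHeight

end

/-! ### Heights of points of an elliptic curve -/

section

open WeierstrassCurve Affine Filter Topology

section weilHeightLegendreCoord

variable {k F Fbar : Type*} [Field k] [IsAlgClosed k] [Field F] [Field Fbar] [Algebra k F]
  [Algebra F Fbar] [Algebra k Fbar] [IsScalarTower k F Fbar] {W : WeierstrassCurve Fbar}
  {e₁ e₂ e₃ l : Fbar}

theorem weilHeight_legendreCoord_zero (hF : IsCurveFunctionField k F) :
    weilHeight k F (W.legendreCoord e₁ e₂ 0) = 0 := by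
  have := weilHeight_algebraMap (Fbar := Fbar) hF 0
  rwa [map_zero] at this

variable [Algebra.IsAlgebraic F Fbar] [DecidableEq Fbar]

theorem weilHeight_legendreCoord_add_add_sub_le (hF : IsCurveFunctionField k F)
    (h2 : (2 : Fbar) ≠ 0) (hW : W.IsTwoTorsionTriple e₁ e₂ e₃) (hl : e₃ - e₁ = (e₂ - e₁) * l)
    (P Q : W.toAffine.Point) :
    weilHeight k F (W.legendreCoord e₁ e₂ (P + Q)) +
        weilHeight k F (W.legendreCoord e₁ e₂ (P - Q)) ≤
      2 * weilHeight k F (W.legendreCoord e₁ e₂ P) +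
        2 * weilHeight k F (W.legendreCoord e₁ e₂ Q) + 2 * weilHeight k F l := by
  have hl0 := weilHeight_nonneg hF l
  have h0 : weilHeight k F (W.legendreCoord e₁ e₂ 0) = 0 := weilHeight_legendreCoord_zero hF
  have hP0 := weilHeight_nonneg hF (W.legendreCoord e₁ e₂ P)
  have hQ0 := weilHeight_nonneg hF (W.legendreCoord e₁ e₂ Q)
  have hdouble : ∀ R : W.toAffine.Point, weilHeight k F (W.legendreCoord e₁ e₂ (R + R)) ≤
      4 * weilHeight k F (W.legendreCoord e₁ e₂ R) + 2 * weilHeight k F l := fun R ↦ by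
    by_cases hR : R + R = 0
    · rw [hR, h0]
      linarith [weilHeight_nonneg hF (W.legendreCoord e₁ e₂ R)]
    · linarith [(hW.legendreDouble h2 hl hR).weilHeight_le hF]
  by_cases hP : P = 0
  · rw [hP, zero_add, zero_sub, legendreCoord_neg, h0]
    linarith
  by_cases hQ : Q = 0
  · rw [hQ, add_zero, sub_zero, h0]
    linarith
  by_cases hne : P = Q
  · rw [hne, sub_self, h0]
    linarith [hdouble Q]
  by_cases hne' : P = -Q
  · have e : -Q - Q = -(Q + Q) := by abel
    rw [hne', neg_add_cancel, h0, e, legendreCoord_neg, legendreCoord_neg]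
    linarith [hdouble Q]
  linarith [(hW.legendreAdd h2 hl hP hQ hne hne').weilHeight_add_le hF]

theorem four_mul_weilHeight_legendreCoord_le (hF : IsCurveFunctionField k F)
    (h2k : (2 : k) ≠ 0) (h2 : (2 : Fbar) ≠ 0) (hW : W.IsTwoTorsionTriple e₁ e₂ e₃)
    (hl : e₃ - e₁ = (e₂ - e₁) * l) (P : W.toAffine.Point) :
    4 * weilHeight k F (W.legendreCoord e₁ e₂ P) ≤
      weilHeight k F (W.legendreCoord e₁ e₂ (P + P)) + 5 * weilHeight k F l := by
  have hl0 := weilHeight_nonneg hF l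
  have h0 : weilHeight k F (0 : Fbar) = 0 := by
    have := weilHeight_algebraMap (Fbar := Fbar) hF 0
    rwa [map_zero] at this
  have h1 : weilHeight k F (1 : Fbar) = 0 := by
    have := weilHeight_algebraMap (Fbar := Fbar) hF 1
    rwa [map_one] at this
  have hl0' : l ≠ 0 := by
    rintro rfl
    exact hW.ne₁₃ (by rw [hl, mul_zero])
  have hl1' : l ≠ 1 := fun h ↦ hW.ne₂₃ (by linear_combination hl + (e₂ - e₁) * h)
  by_cases hP : P + P = 0
  · rw [hP, weilHeight_legendreCoord_zero hF, zero_add]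
    suffices h : W.legendreCoord e₁ e₂ P = 0 ∨ W.legendreCoord e₁ e₂ P = 1 ∨
        W.legendreCoord e₁ e₂ P = l by
      rcases h with h | h | h <;> rw [h] <;> linarith
    rcases P with _ | ⟨x, y, h⟩
    · exact Or.inl rfl
    have hy : y = W.toAffine.negY x y := by
      by_contra hy
      rw [Point.add_self_of_Y_ne hy] at hP
      exact Point.some_ne_zero _ hP
    have := hW.sq_eq hl h
    rw [sub_eq_zero.mpr hy, zero_pow two_ne_zero, eq_comm, mul_eq_zero] at this
    have hc : 4 * (e₂ - e₁) ^ 3 ≠ 0 :=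
      mul_ne_zero (by rw [show (4 : Fbar) = 2 ^ 2 by norm_num]; exact pow_ne_zero 2 h2)
        (pow_ne_zero 3 hW.ne₁₂)
    rcases mul_eq_zero.mp (this.resolve_left hc) with h | h
    · exact (mul_eq_zero.mp h).imp_right fun h ↦ Or.inl (sub_eq_zero.mp h)
    · exact Or.inr (Or.inr (sub_eq_zero.mp h))
  · linarith [(hW.legendreDouble h2 hl hP).four_mul_weilHeight_le hF h2k hl0' hl1']

theorem WeierstrassCurve.IsTwoTorsionTriple.legendreSeq {K : Type*} [Field K] [DecidableEq K]
    {W : WeierstrassCurve K} {e₁ e₂ e₃ l : K} (h2 : (2 : K) ≠ 0)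
    (hW : W.IsTwoTorsionTriple e₁ e₂ e₃) (hl : e₃ - e₁ = (e₂ - e₁) * l)
    {P : W.toAffine.Point} (hP : ¬ IsOfFinAddOrder P) :
    LegendreSeq l fun n ↦ W.legendreCoord e₁ e₂ (n • P) := by
  have hne : ∀ n : ℕ, 0 < n → n • P ≠ 0 := fun n hn h ↦
    hP (isOfFinAddOrder_iff_nsmul_eq_zero.mpr ⟨n, hn, h⟩)
  refine ⟨fun n hn ↦ ?_, fun m n hn hmn ↦ ?_⟩
  · have e : (2 * n) • P = n • P + n • P := by rw [two_mul, add_nsmul]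
    have h0 := hne (2 * n) (by omega)
    simp only [e] at h0 ⊢
    exact hW.legendreDouble h2 hl h0
  · have e : (m - n) • P = m • P - n • P := by
      rw [eq_sub_iff_add_eq, ← add_nsmul, Nat.sub_add_cancel hmn.le]
    simp only [add_nsmul, e]
    refine hW.legendreAdd h2 hl (hne m (by omega)) (hne n hn) (fun h ↦ ?_) fun h ↦ ?_
    · exact hne (m - n) (by omega) (by rw [e, h, sub_self])
    · exact hne (m + n) (by omega) (by rw [add_nsmul, h, neg_add_cancel])

end weilHeightLegendreCoord

section xHeight

variable {k F Fbar : Type*} [Field k] [IsAlgClosed k] [Field F] [Field Fbar] [Algebra k F]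
  [Algebra F Fbar] [Algebra k Fbar] [IsScalarTower k F Fbar] [Algebra.IsAlgebraic F Fbar]
  {E : WeierstrassCurve F} {e₁ e₂ : Fbar}

/-- The coordinates `x` and `u` differ by an affine change of variables, so their heights differ by
a bounded amount. -/
theorem exists_xHeight_le_and_le (hF : IsCurveFunctionField k F) (he : e₂ - e₁ ≠ 0) :
    ∃ B, 0 ≤ B ∧ ∀ P : (E.baseChange Fbar).toAffine.Point,
      xHeight k E P ≤ weilHeight k F ((E.baseChange Fbar).legendreCoord e₁ e₂ P) + B ∧
      weilHeight k F ((E.baseChange Fbar).legendreCoord e₁ e₂ P) ≤ xHeight k E P + B := by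
  have hn := fun a : Fbar ↦ weilHeight_nonneg hF a
  refine ⟨weilHeight k F e₁ + weilHeight k F (e₂ - e₁) + weilHeight k F (-e₁) +
    weilHeight k F (e₂ - e₁)⁻¹, by linarith [hn e₁, hn (e₂ - e₁), hn (-e₁), hn (e₂ - e₁)⁻¹],
    fun P ↦ ?_⟩
  have h1 := hn e₁
  have h2 := hn (e₂ - e₁)
  have h3 := hn (-e₁)
  have h4 := hn (e₂ - e₁)⁻¹
  rcases P with _ | ⟨x, y, h⟩
  · have h0 := weilHeight_algebraMap (Fbar := Fbar) hF 0
    rw [map_zero] at h0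
    simp only [xHeight, legendreCoord, h0]
    constructor <;> linarith
  · simp only [xHeight, legendreCoord]
    have e : x = (x - e₁) / (e₂ - e₁) * (e₂ - e₁) + e₁ := by field_simp; ring
    have h5 := weilHeight_add_le hF ((x - e₁) / (e₂ - e₁) * (e₂ - e₁)) e₁
    have h6 := weilHeight_mul_le hF ((x - e₁) / (e₂ - e₁)) (e₂ - e₁)
    have h7 := weilHeight_add_le hF x (-e₁)
    have h8 := weilHeight_mul_le hF (x + -e₁) (e₂ - e₁)⁻¹
    rw [← e] at h5
    rw [← sub_eq_add_neg] at h7 h8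
    rw [← div_eq_mul_inv] at h8
    constructor <;> linarith

end xHeight

/-- If the Legendre parameter were constant, so would be the `j`-invariant. -/
theorem WeierstrassCurve.IsTwoTorsionTriple.notMem_range_of_j_notMem_range
    {k F Fbar : Type*} [Field k] [Field F] [Field Fbar] [Algebra k F] [Algebra F Fbar]
    [Algebra k Fbar] [IsScalarTower k F Fbar] {E : WeierstrassCurve F} [E.IsElliptic]
    {e₁ e₂ e₃ l : Fbar} (h2 : (2 : Fbar) ≠ 0)
    (hW : (E.baseChange Fbar).IsTwoTorsionTriple e₁ e₂ e₃) (hl : e₃ - e₁ = (e₂ - e₁) * l)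
    (hj : E.j ∉ Set.range (algebraMap k F)) : l ∉ Set.range (algebraMap k Fbar) := by
  rintro ⟨c, rfl⟩
  refine hj ⟨256 * (c ^ 2 - c + 1) ^ 3 / (c ^ 2 * (c - 1) ^ 2), ?_⟩
  have : (E.baseChange Fbar).IsElliptic :=
    inferInstanceAs (E.map (algebraMap F Fbar)).IsElliptic
  apply (algebraMap F Fbar).injective
  rw [← IsScalarTower.algebraMap_apply, ← E.map_j (algebraMap F Fbar)]
  refine Eq.trans ?_ (hW.j_eq h2 hl).symm
  simp [map_ofNat (algebraMap k Fbar)]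

end

/-! ### The inequality for the canonical height -/

theorem mainTheorem6 {k F Fbar : Type*} [Field k] [IsAlgClosed k] [Field F] [Algebra k F]
    [Field Fbar] [Algebra F Fbar] [IsAlgClosure F Fbar] [DecidableEq Fbar]
    (hchar2 : ringChar k ≠ 2) (hchar3 : ringChar k ≠ 3)
    (hF : IsCurveFunctionField k F)
    (E : WeierstrassCurve F) [E.IsElliptic] (hj : E.j ∉ Set.range (algebraMap k F))
    (N : ℕ) (P : Fin (N + 1) → (E.baseChange Fbar).toAffine.Point) :
    (∀ Q : (E.baseChange Fbar).toAffine.Point,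
      Filter.Tendsto (canonicalHeightSeq k E Q) Filter.atTop (nhds (canonicalHeight k E Q))) ∧
    (1 / (2 * ((N : ℝ) + 1) ^ 2)) *
        ∑ p ∈ (Finset.univ : Finset (Fin (N + 1))).offDiag,
          canonicalHeight k E (P p.1 - P p.2) ≤
      Finset.univ.sup' Finset.univ_nonempty (fun i => canonicalHeight k E (P i)) ∧
    (Finset.univ.sup' Finset.univ_nonempty (fun i => canonicalHeight k E (P i)) =
        (1 / (2 * ((N : ℝ) + 1) ^ 2)) *
          ∑ p ∈ (Finset.univ : Finset (Fin (N + 1))).offDiag,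
            canonicalHeight k E (P p.1 - P p.2) ↔
      (∀ i j, canonicalHeight k E (P i) = canonicalHeight k E (P j)) ∧
        IsOfFinAddOrder (∑ i, P i)) := by
  let : Algebra k Fbar := ((algebraMap F Fbar).comp (algebraMap k F)).toAlgebra
  have : IsScalarTower k F Fbar := IsScalarTower.of_algebraMap_eq fun _ ↦ rfl
  have : IsAlgClosed Fbar := IsAlgClosure.isAlgClosed F
  have : Algebra.IsAlgebraic F Fbar := IsAlgClosure.isAlgebraic
  have h2k : (2 : k) ≠ 0 := Ring.two_ne_zero hchar2
  have h2 : (2 : Fbar) ≠ 0 := by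
    rw [← map_ofNat (algebraMap k Fbar) 2]
    exact (map_ne_zero _).mpr h2k
  have : (E.baseChange Fbar).IsElliptic :=
    inferInstanceAs (E.map (algebraMap F Fbar)).IsElliptic
  obtain ⟨e₁, e₂, e₃, hW⟩ := (E.baseChange Fbar).exists_isTwoTorsionTriple h2
  obtain ⟨l, hl⟩ : ∃ l, e₃ - e₁ = (e₂ - e₁) * l := ⟨_, (mul_div_cancel₀ _ hW.ne₁₂).symm⟩
  have hlk := hW.notMem_range_of_j_notMem_range (k := k) h2 hl hj
  have hl0 : l ≠ 0 := fun h ↦ hlk ⟨0, by rw [h, map_zero]⟩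
  have hl1 : l ≠ 1 := fun h ↦ hlk ⟨1, by rw [h, map_one]⟩
  have hlpos := weilHeight_pos hF hlk
  obtain ⟨B, hB0, hB⟩ := exists_xHeight_le_and_le (E := E) hF hW.ne₁₂
  have hnonneg : ∀ Q, 0 ≤ xHeight k E (Fbar := Fbar) Q := fun Q ↦ by
    rcases Q with _ | ⟨x, y, h⟩
    · exact le_rfl
    · exact weilHeight_nonneg hF x
  have hadd : ∀ Q R, xHeight k E (Fbar := Fbar) (Q + R) + xHeight k E (Q - R) ≤
      2 * xHeight k E Q + 2 * xHeight k E R + (5 * weilHeight k F l + 6 * B) := fun Q R ↦ by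
    have := weilHeight_legendreCoord_add_add_sub_le hF h2 hW hl Q R
    linarith [(hB (Q + R)).1, (hB (Q - R)).1, (hB Q).2, (hB R).2]
  have hdouble : ∀ Q, 4 * xHeight k E (Fbar := Fbar) Q ≤
      xHeight k E (Q + Q) + (5 * weilHeight k F l + 6 * B) := fun Q ↦ by
    have := four_mul_weilHeight_legendreCoord_le hF h2k h2 hW hl Q
    linarith [(hB (Q + Q)).2, (hB Q).1]
  have htendsto : ∀ Q : (E.baseChange Fbar).toAffine.Point,
      Filter.Tendsto (canonicalHeightSeq k E Q) Filter.atTop (nhds (canonicalHeight k E Q)) :=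
    fun Q ↦ tendsto_nhds_limUnder (exists_tendsto_inv_four_pow_mul hnonneg hadd hdouble Q)
  have hpar := parallelogram_law_of_tendsto hadd htendsto
  refine ⟨htendsto, max_ge_sum_offDiag_and_eq_iff hpar (fun Q ↦ ge_of_tendsto' (htendsto Q)
    fun n ↦ mul_nonneg (by positivity) (hnonneg _)) (fun Q hQ ↦ ?_) N P⟩
  -- a point of infinite order has a multiple of height at least `h(l)`
  by_contra htors
  obtain ⟨n, hn, hle⟩ := (hW.legendreSeq h2 hl htors).exists_pow_mul_weilHeight_le hF h2k hl0 hl1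
    (by rw [zero_nsmul]; rfl)
  have hnQ := map_nsmul_of_parallelogram_law hpar n Q
  rw [hQ, mul_zero] at hnQ
  have hlim := (htendsto (n • Q)).add (tendsto_inv_four_pow_mul_const (B + weilHeight k F l))
  rw [hnQ, add_zero] at hlim
  refine hlpos.not_ge (ge_of_tendsto' hlim fun j ↦ ?_)
  have h1 := hle j
  rw [mul_comm n, mul_nsmul'] at h1
  have h2 := (hB ((2 ^ j : ℕ) • n • Q)).2
  rw [canonicalHeightSeq, ← mul_add, ← mul_le_mul_iff_right₀ (by positivity : (0 : ℝ) < 4 ^ j),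
    mul_inv_cancel_left₀ (by positivity)]
  linarith
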